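/- Let $G=(\mathcal V,\mathcal E)$ be a simple, locally finite, connected graph with a root $\mathbf 0\in\mathcal V$. Let $K:\mathcal V\times\mathcal V\to[0,1]$ be a transition kernel with $K(u,v)=0$ when $u,v$ are not adjacent and $\sum_{v}K(u,v)=1$ for every $u$. Let $\Gamma$ be a group of $K$-preserving automorphisms of $G$ such that - (transitivity) $\Gamma$ acts transitively on $\mathcal V$; - (unimodularity) $|\Gamma(u,u)v|=|\Gamma(v,v)u|<\infty$ for all $u,v$, where $\Gamma(u,u)$ is the stabilizer of $u$ in $\Gamma$; - (infinite accessibility) for some $\varphi\in\Gamma$ and $u\in\mathcal V$ the set $\{\varphi^n(u):n\ge 0\}$ is infinite and there is a finite sequence of vertices from $\varphi(u)$ to $u$ along which all transition probabilities are positive. Fix rates $\lambda_A>0$, $\lambda_B\ge 0$, caps $M,N\in[0,\infty]$ and $p\in[0,1]$. In the diffusion-limited annihilating-coalescing system, each vertex $x$ starts independently with a single particle, which is an $A_1$-particle with probability $p$ and a $B_1$-particle otherwise. It carries an independent discrete path of the $K$-walk started at $x$, an independent Poisson clock, of rate $\lambda_A$ or $\lambda_B$ according to its type, at whose rings it jumps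 along its path, and an independent bravery, uniform on $(0,1)$. Particles at the same site react pairwise, with priority to the highest braveries, until no reaction is possible: $A_i+B_j\to\varnothing$; $A_i+A_j\to A_{i+j}$ if $\max(i,j)\le M$; $B_i+B_j\to B_{i+j}$ if $\max(i,j)\le N$; there are no other reactions. A coalesced particle keeps the path, clock and bravery of the braver of the two. An $A_i$-particle is viewed as a cluster of $i$ initial $A$-particles. The system with infinitely many particles is the local limit of the systems that start with the particles of a finite set $\Lambda\uparrow\mathcal V$ of vertices only. Let $\xi^i_t(x)$ be the number of $A_i$-particles at $x$ at time $t$, and put $$W_T=\int_0^T\sum_{i\ge1} i\,\xi^i_t(\mathbf 0)\,dt,\qquad V_T=\int_0^T\sum_{i\ge1}\xi^i_t(\mathbf 0)\,dt .$$ Let $\tau(\mathfrak a_{\mathbf 0})\in[0,\infty]$ be the time at which the cluster containing the $A$-particle started at $\mathbf 0$ is annihilated by a $B$-particle, with $\tau(\mathfrak a_{\mathbf 0})=0$ if $\mathbf 0$ starts with a $B$-particle and $\tau(\mathfrak a_{\mathbf 0})=\infty$ if it starts with an $A$-particle that is never annihilated. Let $\theta$ be the probability that $\mathbf 0$ starts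 with an $A$-particle that is never annihilated (coalescing with other $A$-particles counts as surviving). **Theorem.** For all $T\ge 0$, $$\mathbb E[W_T]=\int_0^T\mathbb P(\tau(\mathfrak a_{\mathbf 0})>t)\,dt\;\ge\;\theta\,T .$$ If moreover $M<\infty$, then $$\mathbb E[V_T]\;\ge\;\frac{\theta}{\max(1,2M)}\,T,$$ that is, $\mathbb E[V_T]\ge\theta T/(2M)$ whenever $M\ge 1/2$, in particular for every integer cap $M\ge1$. -/

import Mathlib

open MeasureTheory ProbabilityTheory Set
open scoped ENNReal NNReal

noncomputable section

namespace DLACS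

/-! ### The graph and the random walk kernel -/

/-- `K` is a nearest-neighbour Markov transition kernel on `G`. -/
structure IsWalkKernel {V : Type*} (G : SimpleGraph V) [G.LocallyFinite] (K : V → V → ℝ≥0) :
    Prop where
  eq_zero : ∀ u v, ¬ G.Adj u v → K u v = 0
  sum_eq_one : ∀ u, ∑ v ∈ G.neighborFinset u, K u v = 1

/-- Every element of `Γ` is a `K`-preserving automorphism of `G`. -/
def PreservesKernel {V : Type*} {G : SimpleGraph V} (K : V → V → ℝ≥0) (Γ : Subgroup (G ≃g G)) :
    Prop :=
  ∀ φ ∈ Γ, ∀ u v, K u v = K (φ u) (φ v)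

/-- `Γ` acts transitively on the vertices. -/
def IsTransitive {V : Type*} {G : SimpleGraph V} (Γ : Subgroup (G ≃g G)) : Prop :=
  ∀ u v, ∃ φ ∈ Γ, φ u = v

/-- The orbit of `v` under the stabilizer of `u` in `Γ`. -/
def stabOrbit {V : Type*} {G : SimpleGraph V} (Γ : Subgroup (G ≃g G)) (u v : V) : Set V :=
  {w | ∃ φ ∈ Γ, φ u = u ∧ φ v = w}

/-- Unimodularity: `|Γ(u,u) v| = |Γ(v,v) u| < ∞` for all `u`, `v`. -/
def IsUnimodular {V : Type*} {G : SimpleGraph V} (Γ : Subgroup (G ≃g G)) : Prop :=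
  ∀ u v, (stabOrbit Γ u v).Finite ∧ (stabOrbit Γ u v).encard = (stabOrbit Γ v u).encard

/-- `Accessible K v u`: there are `v = x₀, …, xₙ = u` with `K xᵢ xᵢ₊₁ > 0` for all `i < n`,
that is, `u` is accessible from `v`. -/
def Accessible {V : Type*} (K : V → V → ℝ≥0) (v u : V) : Prop :=
  Relation.ReflTransGen (fun a b => 0 < K a b) v u

/-- Infinite accessibility: for some `φ ∈ Γ` and some vertex `u`, the set `{φⁿ u : n ≥ 0}` is
infinite and `u` is accessible from `φ u`. -/
def IsInfinitelyAccessible {V : Type*} {G : SimpleGraph V} (K : V → V → ℝ≥0)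
    (Γ : Subgroup (G ≃g G)) : Prop :=
  ∃ φ ∈ Γ, ∃ u : V, (Set.range fun n : ℕ => (φ ^ n) u).Infinite ∧ Accessible K (φ u) u

/-! ### The driving randomness -/

/-- One realization of the randomness: each vertex `x` carries one initial particle (called
the particle `x`), with its type, its discrete path, the successive waiting times of a unit rate
clock, and its bravery. -/
structure Env (V : Type*) where
  /-- `true` if the particle started at `x` is an `A`-particle, `false` if it is a `B`-particle -/
  isA : V → Bool
  /-- the discrete random walk path assigned to the particle started at `x` -/
  path : V → ℕ → V
  /-- the waiting times of a unit rate clock, to be run at the rate of the particle's type -/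
  clock : V → ℕ → ℝ
  /-- the bravery of the particle started at `x` -/
  bravery : V → ℝ

/-- `E` is a random environment with kernel `K` and density `p` of `A`-particles: all sites, and
at each site the type, the path, the waiting times and the bravery, are independent; a type
is `A` with probability `p`; the path of `x` is the Markov chain with kernel `K` started at `x`;
waiting times are exponential of rate one; braveries are uniform on `(0, 1)`. -/
structure IsRandomEnv {V : Type*} [MeasurableSpace V] (K : V → V → ℝ≥0) (p : ℝ)
    {Ω : Type*} [MeasurableSpace Ω] (P : Measure Ω) (E : Ω → Env V) : Prop where
  measurable_isA : ∀ x, Measurable fun ω => (E ω).isA x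
  measurable_path : ∀ x, Measurable fun ω => (E ω).path x
  measurable_clock : ∀ x, Measurable fun ω => (E ω).clock x
  measurable_bravery : ∀ x, Measurable fun ω => (E ω).bravery x
  indep_sites :
    iIndepFun (fun x ω => ((E ω).isA x, (E ω).path x, (E ω).clock x, (E ω).bravery x)) P
  indep_isA : ∀ x,
    IndepFun (fun ω => (E ω).isA x) (fun ω => ((E ω).path x, (E ω).clock x, (E ω).bravery x)) P
  indep_path : ∀ x,
    IndepFun (fun ω => (E ω).path x) (fun ω => ((E ω).clock x, (E ω).bravery x)) P
  indep_clock_bravery : ∀ x, IndepFun (fun ω => (E ω).clock x) (fun ω => (E ω).bravery x) P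
  indep_clock : ∀ x, iIndepFun (fun n ω => (E ω).clock x n) P
  law_isA : ∀ x, P {ω | (E ω).isA x = true} = ENNReal.ofReal p
  law_start : ∀ x, ∀ᵐ ω ∂P, (E ω).path x 0 = x
  law_path : ∀ x (n : ℕ) (s : ℕ → V), s 0 = x →
    P {ω | ∀ k ≤ n, (E ω).path x k = s k}
      = ∏ k ∈ Finset.range n, (K (s k) (s (k + 1)) : ℝ≥0∞)
  law_clock : ∀ x n, P.map (fun ω => (E ω).clock x n) = expMeasure 1
  law_bravery : ∀ x, P.map (fun ω => (E ω).bravery x) = volume.restrict (Ioo 0 1)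

/-- The parameters of the system: jump rates and caps of the two types. -/
structure Params where
  /-- jump rate `λ_A` of `A`-particles -/
  rateA : ℝ
  /-- jump rate `λ_B` of `B`-particles -/
  rateB : ℝ
  /-- cap `M` of `A`-particles -/
  capA : ℝ≥0∞
  /-- cap `N` of `B`-particles -/
  capB : ℝ≥0∞

variable {V : Type*}

/-- The jump rate of the particle `y`. -/
def rate (q : Params) (e : Env V) (y : V) : ℝ := if e.isA y then q.rateA else q.rateB

/-- The cap that applies to the particle `y`. -/
def cap (q : Params) (e : Env V) (y : V) : ℝ≥0∞ := if e.isA y then q.capA else q.capB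

/-- The time of the `n`-th jump (counted from `0`) along the path of `y`; it is `∞` when the
rate is `0`. -/
def ring (q : Params) (e : Env V) (y : V) (n : ℕ) : ℝ≥0∞ :=
  ENNReal.ofReal (∑ k ∈ Finset.range (n + 1), e.clock y k) / ENNReal.ofReal (rate q e y)

/-- The position at time `s` on the path of `y`. -/
def pos (q : Params) (e : Env V) (y : V) (s : ℝ≥0∞) : V :=
  e.path y {n | ring q e y n ≤ s}.ncard

/-! ### Reactions

A configuration `c : V → Option V` describes which clusters the initial particles form:
`c u = some y` means that the particle `u` belongs to a cluster which follows the path and has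
the bravery of the particle `y` (the leader of the cluster), and `c u = none` means that `u` is not
in the system. A cluster of `i` particles of type `A` is an `A_i`-particle, and a cluster of
`i` particles of type `B` is a `B_i`-particle. -/

/-- The size of the cluster led by `y`. -/
def size (c : V → Option V) (y : V) : ℕ := {u | c u = some y}.ncard

/-- The clusters led by `y` and by `z`, of which the first is the braver, are at the same
site at time `s` and react with each other: they are of opposite types, or they are of the same type
and neither size exceeds the cap. -/
def Reacts (q : Params) (e : Env V) (s : ℝ≥0∞) (c : V → Option V) (y z : V) : Prop :=
  c y = some y ∧ c z = some z ∧ e.bravery z < e.bravery y ∧ pos q e y s = pos q e z s ∧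
    (e.isA y ≠ e.isA z ∨ ((max (size c y) (size c z) : ℕ) : ℝ≥0∞) ≤ cap q e y)

/-- `(y, z)` is the reacting pair of highest priority: bravest first member, and then
bravest second member. -/
def IsTopPair (q : Params) (e : Env V) (s : ℝ≥0∞) (c : V → Option V) (a : V × V) : Prop :=
  Reacts q e s c a.1 a.2 ∧ ∀ y z, Reacts q e s c y z →
    e.bravery y < e.bravery a.1 ∨
      (e.bravery y = e.bravery a.1 ∧ e.bravery z ≤ e.bravery a.2)

open Classical in
/-- The reaction of the clusters led by `y` and `z`, of which the first is the braver:
unlike clusters are both removed, and like clusters form one cluster led by `y`. -/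
def merge (e : Env V) (c : V → Option V) (y z : V) : V → Option V := fun u =>
  if c u = some y ∨ c u = some z then (if e.isA y = e.isA z then some y else none) else c u

open Classical in
/-- The reacting pair of highest priority reacts, if there is a reacting pair. -/
def reactStep (q : Params) (e : Env V) (s : ℝ≥0∞) (c : V → Option V) : V → Option V :=
  if h : ∃! a : V × V, IsTopPair q e s c a then merge e c h.choose.1 h.choose.2 else c

/-! ### The system with finitely many particles -/

/-- The first time after `s` at which a particle with initial position in `Λ` jumps. -/
def nextRing (q : Params) (e : Env V) (Λ : Finset V) (s : ℝ≥0∞) : ℝ≥0∞ :=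
  sInf {r | s < r ∧ ∃ y ∈ Λ, ∃ n, ring q e y n = r}

/-- The successive jump times of the particles with initial position in `Λ`, preceded by `0`. -/
def eventTime (q : Params) (e : Env V) (Λ : Finset V) : ℕ → ℝ≥0∞
  | 0 => 0
  | k + 1 => nextRing q e Λ (eventTime q e Λ k)

open Classical in
/-- The configuration after `k` jumps in the system which starts with the particles of `Λ`
only. After each jump the clusters react pairwise until no further reaction is possible; each
reaction lowers the number of clusters, so `Λ.card` reactions suffice. -/
def config (q : Params) (e : Env V) (Λ : Finset V) : ℕ → V → Option V
  | 0 => fun u => if u ∈ Λ then some u else none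
  | k + 1 => (reactStep q e (eventTime q e Λ (k + 1)))^[Λ.card] (config q e Λ k)

/-- The configuration at time `t` in the system which starts with the particles of `Λ` only. -/
def configAt (q : Params) (e : Env V) (Λ : Finset V) (t : ℝ) : V → Option V :=
  config q e Λ {k | eventTime q e Λ (k + 1) ≤ ENNReal.ofReal t}.ncard

/-! ### The full system, as the local limit of the finite systems -/

/-- At time `t` the particle `u` belongs to a cluster led by `y` in the full system: the history of
`u` on `[0, t]` is the same in all sufficiently large finite systems, and ends with leader `y`. -/
def LedBy (q : Params) (e : Env V) (t : ℝ) (u y : V) : Prop :=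
  ∃ Λ₀ : Finset V, configAt q e Λ₀ t u = some y ∧
    ∀ Λ : Finset V, Λ₀ ⊆ Λ → ∀ s ∈ Icc 0 t, configAt q e Λ s u = configAt q e Λ₀ s u

/-- The particle `u` has not been annihilated by time `t`. -/
def InSystem (q : Params) (e : Env V) (t : ℝ) (u : V) : Prop := ∃ y, LedBy q e t u y

/-- The lifespan `τ(𝔞_u)`: the time at which the cluster of the `A`-particle `u` is annihilated,
`∞` if this never happens, and `0` if `u` initially contains a `B`-particle. -/
def lifespan (q : Params) (e : Env V) (u : V) : ℝ≥0∞ :=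
  if e.isA u then sInf {r | ∃ t : ℝ, 0 ≤ t ∧ ENNReal.ofReal t = r ∧ ¬ InSystem q e t u} else 0

/-- The vertex `u` initially contains an `A`-particle which is never annihilated. -/
def Survives (q : Params) (e : Env V) (u : V) : Prop :=
  e.isA u = true ∧ ∀ t : ℝ, 0 ≤ t → InSystem q e t u

/-- `ξ^i_t(x)`: the number of `A_i`-particles at `x` at time `t`. -/
def numA (q : Params) (e : Env V) (i : ℕ) (t : ℝ) (x : V) : ℕ∞ :=
  {y | e.isA y = true ∧ LedBy q e t y y ∧ pos q e y (ENNReal.ofReal t) = x ∧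
    {u | LedBy q e t u y}.encard = i}.encard

/-- `W_T(x) = ∫₀ᵀ ∑_{i ≥ 1} i ξ^i_t(x) dt`, the weighted occupation time of `x`. -/
def weightedOccupation (q : Params) (e : Env V) (T : ℝ) (x : V) : ℝ≥0∞ :=
  ∫⁻ t in Icc 0 T, ∑' i : ℕ, ((i + 1 : ℕ) : ℝ≥0∞) * (numA q e (i + 1) t x : ℝ≥0∞)

/-- `V_T(x) = ∫₀ᵀ ∑_{i ≥ 1} ξ^i_t(x) dt`, the occupation time of `x`. -/
def occupation (q : Params) (e : Env V) (T : ℝ) (x : V) : ℝ≥0∞ :=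
  ∫⁻ t in Icc 0 T, ∑' i : ℕ, (numA q e (i + 1) t x : ℝ≥0∞)

end DLACS

end

namespace DLACS

variable {V : Type*} {q : Params} {e : Env V} {s : ℝ≥0∞} {Λ : Finset V}

/-! ### Configurations of the finite systems -/

/-! Fix a time `t` and let every initial `A`-particle still in the system send unit mass to the site
of its cluster. The expected mass sent from the root is the probability that it starts with an
`A`-particle alive at `t`; the expected mass received there is the mean of `∑ i ξ^i_t`. The mass
transport principle (`tsum_left_eq_tsum_right`) equates the two, and Tonelli integrates the identity
over `[0, T]` (`lintegral_weightedOccupation`). Being alive at `t` and having lifespan greater than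
`t` have equal probability for almost every `t` (`ae_measure_lt_lifespan`). Survivors have infinite
lifespan, which gives the bound `θ T`.

For the unweighted occupation time, `A`-clusters merge only when both sizes are at most `M`, so no
finite `A`-cluster is larger than `max 1 (2 * M)` (`encard_cluster_le`), and the weighted time is at
most that multiple of the unweighted one.

Transport needs a diagonally invariant kernel: the dynamics commute with relabelling of vertices
(`ledByRat_relabel`), and symmetries of `K` preserve the law of the environment
(`map_sites_relabel`). Almost surely no clock explodes, so finite-system histories are
right-continuous step functions; rational times then suffice, which yields measurability. -/

theorem reactStep_eq_or (q : Params) (e : Env V) (s : ℝ≥0∞) (c : V → Option V) :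
    reactStep q e s c = c ∨
      ∃ y z, Reacts q e s c y z ∧ reactStep q e s c = merge e c y z := by
  unfold reactStep
  split_ifs with h
  · exact Or.inr ⟨_, _, h.choose_spec.1.1, rfl⟩
  · exact Or.inl rfl

/-- The properties shared by all the configurations of the system started from `Λ`. -/
structure IsClustering (q : Params) (e : Env V) (Λ : Finset V) (c : V → Option V) : Prop where
  mem : ∀ u y, c u = some y → u ∈ Λ
  leader : ∀ u y, c u = some y → c y = some y
  isA : ∀ u y, c u = some y → e.isA u = e.isA y
  size_le : ∀ y, e.isA y = true → (size c y : ℝ≥0∞) ≤ max 1 (2 * q.capA)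

/-- The configuration `c'` is later than `c`: removed particles stay removed, and particles which
do not lead a cluster never lead a cluster again. -/
def Precedes (c c' : V → Option V) : Prop :=
  ∀ u, (c u = none → c' u = none) ∧ (c' u = some u → c u = some u)

theorem Precedes.refl (c : V → Option V) : Precedes c c := fun _ => ⟨id, id⟩

theorem Precedes.trans {c c' c'' : V → Option V} (h : Precedes c c') (h' : Precedes c' c'') :
    Precedes c c'' :=
  fun u => ⟨fun hu => (h' u).1 ((h u).1 hu), fun hu => (h u).2 ((h' u).2 hu)⟩

theorem Reacts.ne {c : V → Option V} {y z : V} (h : Reacts q e s c y z) : y ≠ z := by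
  rintro rfl
  exact lt_irrefl _ h.2.2.1

theorem precedes_merge {c : V → Option V} {y z : V} (h : Reacts q e s c y z) :
    Precedes c (merge e c y z) := by
  intro u
  have hy := h.1
  unfold merge
  refine ⟨fun hu => by simp [hu], ?_⟩
  split_ifs with h1 h2
  · intro hu
    obtain rfl : y = u := by simpa using hu
    exact hy
  · simp
  · exact id

/-- The size bound is the substantial part. A merger joins two clusters of size at most the cap,
whence the factor 2; the 1 in the maximum covers initial particles when the cap is small. Every
cluster other than the merged one is either unchanged or emptied. -/
theorem IsClustering.merge {c : V → Option V} {y z : V} (hc : IsClustering q e Λ c)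
    (h : Reacts q e s c y z) : IsClustering q e Λ (merge e c y z) := by
  have hne := h.ne
  obtain ⟨hy, hz, -, -, hcap⟩ := h
  have hmem : ∀ u w, DLACS.merge e c y z u = some w → ∃ w', c u = some w' := by
    intro u w hu
    unfold DLACS.merge at hu
    split_ifs at hu with h1 h2
    · rcases h1 with h1 | h1 <;> exact ⟨_, h1⟩
    · exact ⟨_, hu⟩
  refine ⟨fun u w hu => (hmem u w hu).elim fun w' => hc.mem u w', ?_, ?_, ?_⟩
  · intro u w hu
    unfold DLACS.merge at hu ⊢
    split_ifs at hu with h1 h2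
    · obtain rfl : y = w := by simpa using hu
      simp [hy, h2]
    · have hw := hc.leader u w hu
      have h1' : ¬ (c w = some y ∨ c w = some z) := by
        rw [hw, ← hu]; exact h1
      rw [if_neg h1', hw]
  · intro u w hu
    unfold DLACS.merge at hu
    split_ifs at hu with h1 h2
    · obtain rfl : y = w := by simpa using hu
      rcases h1 with h1 | h1
      · exact hc.isA _ _ h1
      · rw [hc.isA _ _ h1, h2]
    · exact hc.isA _ _ hu
  · intro w hw
    by_cases h2 : e.isA y = e.isA z
    · by_cases hwy : w = y
      · subst hwy
        have hsize : size (DLACS.merge e c w z) w ≤ size c w + size c z := by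
          have : {u | DLACS.merge e c w z u = some w} = {u | c u = some w} ∪ {u | c u = some z} := by
            ext u
            simp only [DLACS.merge, h2, if_true, mem_ofPred_eq, mem_union]
            split_ifs with h1 <;> simp_all
          rw [size, this]
          exact ncard_union_le _ _
        rcases hcap with hcap | hcap
        · exact absurd h2 hcap
        · simp only [cap, hw, if_true] at hcap
          refine le_max_of_le_right ?_
          calc (size (DLACS.merge e c w z) w : ℝ≥0∞) ≤ ((size c w + size c z : ℕ) : ℝ≥0∞) := by
                exact_mod_cast hsize
            _ ≤ ((2 * max (size c w) (size c z) : ℕ) : ℝ≥0∞) := by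
                refine Nat.cast_le.2 ?_
                omega
            _ ≤ 2 * q.capA := by
                push_cast at hcap ⊢
                gcongr
      · have hle : {u | DLACS.merge e c y z u = some w} = {u | c u = some w} ∨
            {u | DLACS.merge e c y z u = some w} = ∅ := by
          by_cases hwz : w = z
          · right
            ext u
            simp only [DLACS.merge, h2, if_true, mem_ofPred_eq, mem_empty_iff_false, iff_false]
            split_ifs with h1
            · simpa using Ne.symm hwy
            · exact fun h3 => h1 (Or.inr (hwz ▸ h3))
          · left
            ext u
            simp only [DLACS.merge, h2, if_true, mem_ofPred_eq]
            split_ifs with h1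
            · rcases h1 with h1 | h1 <;> simp [h1, Ne.symm hwy, Ne.symm hwz]
            · rfl
        rcases hle with hle | hle
        · rw [size, hle]; exact hc.size_le w hw
        · simp [size, hle]
    · have hle : {u | DLACS.merge e c y z u = some w} = {u | c u = some w} ∨
          {u | DLACS.merge e c y z u = some w} = ∅ := by
        by_cases hwz : w = z ∨ w = y
        · right
          ext u
          simp only [DLACS.merge, h2, if_false, mem_ofPred_eq, mem_empty_iff_false, iff_false]
          split_ifs with h1
          · simp
          · rcases hwz with rfl | rfl <;> simp_all
        · left
          ext u
          simp only [DLACS.merge, h2, if_false, mem_ofPred_eq]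
          push Not at hwz
          split_ifs with h1
          · rcases h1 with h1 | h1 <;> simp [h1, Ne.symm hwz.1, Ne.symm hwz.2]
          · rfl
      rcases hle with hle | hle
      · rw [size, hle]; exact hc.size_le w hw
      · simp [size, hle]

theorem IsClustering.reactStep {c : V → Option V} (hc : IsClustering q e Λ c) (s : ℝ≥0∞) :
    IsClustering q e Λ (reactStep q e s c) := by
  rcases reactStep_eq_or q e s c with h | ⟨y, z, hr, h⟩ <;> rw [h]
  exacts [hc, hc.merge hr]

theorem precedes_reactStep (q : Params) (e : Env V) (s : ℝ≥0∞) (c : V → Option V) :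
    Precedes c (reactStep q e s c) := by
  rcases reactStep_eq_or q e s c with h | ⟨y, z, hr, h⟩ <;> rw [h]
  exacts [.refl c, precedes_merge hr]

theorem isClustering_config (q : Params) (e : Env V) (Λ : Finset V) (k : ℕ) :
    IsClustering q e Λ (config q e Λ k) := by
  induction k with
  | zero =>
    refine ⟨?_, ?_, ?_, ?_⟩
    · intro u y h
      by_contra hu
      simp [config, hu] at h
    · intro u y h
      simp only [config] at h ⊢
      split_ifs at h with hu
      obtain rfl : u = y := by simpa using h
      simp [hu]
    · intro u y h
      simp only [config] at h
      split_ifs at h with hu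
      obtain rfl : u = y := by simpa using h
      rfl
    · intro y _
      refine le_max_of_le_left ?_
      have : {u | config q e Λ 0 u = some y} ⊆ {y} := by
        intro u h
        simp only [config, mem_ofPred_eq] at h
        split_ifs at h with hu
        simpa using h
      have h1 := ncard_le_ncard this
      rw [ncard_singleton] at h1
      exact_mod_cast h1
  | succ k ih =>
    simp only [config]
    -- The number of reactions after a jump is immaterial here, so the induction runs over an
    -- arbitrary number of iterations.
    generalize Λ.card = n
    induction n with
    | zero => exact ih
    | succ n ihn =>
      rw [Function.iterate_succ_apply']
      exact ihn.reactStep _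

theorem precedes_config (q : Params) (e : Env V) (Λ : Finset V) {k l : ℕ} (h : k ≤ l) :
    Precedes (config q e Λ k) (config q e Λ l) := by
  induction h with
  | refl => exact .refl _
  | @step l _ ih =>
    refine ih.trans ?_
    simp only [config]
    generalize Λ.card = n
    induction n with
    | zero => exact .refl _
    | succ n ihn =>
      rw [Function.iterate_succ_apply']
      exact ihn.trans (precedes_reactStep _ _ _ _)

/-! ### Event times -/

/-- Every particle jumps only finitely often in bounded time. -/
def NonExplosive (q : Params) (e : Env V) : Prop :=
  ∀ (y : V) (t : ℝ), {n | ring q e y n ≤ ENNReal.ofReal t}.Finite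

theorem NonExplosive.finite_rings (h : NonExplosive q e) (Λ : Finset V) (t : ℝ) :
    {r | r ≤ ENNReal.ofReal t ∧ ∃ y ∈ Λ, ∃ n, ring q e y n = r}.Finite := by
  refine ((Λ.finite_toSet.biUnion fun y _ => (h y t).image (ring q e y))).subset ?_
  rintro r ⟨hr, y, hy, n, rfl⟩
  exact mem_biUnion hy ⟨n, hr, rfl⟩

/-- Only finitely many rings lie below any finite level, so the infimum is attained; in particular
it cannot collapse to `s` through an accumulation of rings. -/
theorem NonExplosive.nextRing_mem (h : NonExplosive q e) (Λ : Finset V) (s : ℝ≥0∞)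
    (hs : nextRing q e Λ s ≠ ∞) :
    s < nextRing q e Λ s ∧ ∃ y ∈ Λ, ∃ n, ring q e y n = nextRing q e Λ s := by
  set R : Set ℝ≥0∞ := {r | s < r ∧ ∃ y ∈ Λ, ∃ n, ring q e y n = r} with hR
  obtain ⟨r₀, hr₀, hr₀'⟩ : ∃ r ∈ R, r < ∞ := by
    rw [← sInf_lt_iff]
    exact lt_of_le_of_ne le_top hs
  have hfin : (R ∩ Iic r₀).Finite := by
    refine (h.finite_rings Λ r₀.toReal).subset ?_
    rintro r ⟨⟨_, hr⟩, hr'⟩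
    rw [mem_ofPred_eq, ENNReal.ofReal_toReal hr₀'.ne]
    exact ⟨hr', hr⟩
  have hne : (R ∩ Iic r₀).Nonempty := ⟨r₀, hr₀, mem_Iic.2 le_rfl⟩
  have hmin := hne.csInf_mem hfin
  have heq : sInf R = sInf (R ∩ Iic r₀) := by
    refine le_antisymm (sInf_le_sInf inter_subset_left) (le_sInf fun r hr => ?_)
    rcases le_total r r₀ with hle | hle
    · exact sInf_le ⟨hr, hle⟩
    · exact (sInf_le (show r₀ ∈ R ∩ Iic r₀ from ⟨hr₀, mem_Iic.2 le_rfl⟩)).trans hle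
  have : nextRing q e Λ s ∈ R := by
    change sInf R ∈ R
    rw [heq]
    exact hmin.1
  exact this

theorem le_nextRing (q : Params) (e : Env V) (Λ : Finset V) (s : ℝ≥0∞) :
    s ≤ nextRing q e Λ s :=
  le_sInf fun _ hr => hr.1.le

theorem monotone_eventTime (q : Params) (e : Env V) (Λ : Finset V) :
    Monotone (eventTime q e Λ) :=
  monotone_nat_of_le_succ fun _ => le_nextRing _ _ _ _

/-- As long as they are finite, event times increase strictly and are rings, so their indices inject
into a finite set of rings. This matters because `configAt` is indexed by an `ncard`, which would
drop to zero on an infinite set. -/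
theorem NonExplosive.finite_eventTime_le (h : NonExplosive q e) (Λ : Finset V) (t : ℝ) :
    {k | eventTime q e Λ (k + 1) ≤ ENNReal.ofReal t}.Finite := by
  have hlt : ∀ k, eventTime q e Λ (k + 1) ≠ ∞ →
      eventTime q e Λ k < eventTime q e Λ (k + 1) ∧
        ∃ y ∈ Λ, ∃ n, ring q e y n = eventTime q e Λ (k + 1) :=
    fun k hk => h.nextRing_mem Λ _ hk
  refine Set.Finite.of_finite_image (f := fun k => eventTime q e Λ (k + 1))
    ((h.finite_rings Λ t).subset ?_) ?_
  · rintro _ ⟨k, hk, rfl⟩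
    exact ⟨hk, (hlt k (ne_top_of_le_ne_top ENNReal.ofReal_ne_top hk)).2⟩
  · have aux : ∀ k l, k < l → eventTime q e Λ (l + 1) ≤ ENNReal.ofReal t →
        eventTime q e Λ (k + 1) ≠ eventTime q e Λ (l + 1) := by
      intro k l hkl hl
      exact ((monotone_eventTime q e Λ hkl).trans_lt
        (hlt l (ne_top_of_le_ne_top ENNReal.ofReal_ne_top hl)).1).ne
    intro k hk l hl hkl
    rcases lt_trichotomy k l with h' | h' | h'
    · exact absurd hkl (aux k l h' hl)
    · exact h'
    · exact absurd hkl.symm (aux l k h' hk)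

theorem isClustering_configAt (q : Params) (e : Env V) (Λ : Finset V) (t : ℝ) :
    IsClustering q e Λ (configAt q e Λ t) :=
  isClustering_config _ _ _ _

theorem NonExplosive.precedes_configAt (h : NonExplosive q e) (Λ : Finset V) {s t : ℝ}
    (hst : s ≤ t) : Precedes (configAt q e Λ s) (configAt q e Λ t) :=
  precedes_config _ _ _ <| ncard_le_ncard
    (fun _ hk => le_trans hk (ENNReal.ofReal_le_ofReal hst)) (h.finite_eventTime_le Λ t)

open Filter Topology in
-- Right-continuity: of the finitely many event times up to `s + 1`, each one later than `s` is also
-- later than every `r` close enough to `s`.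
theorem NonExplosive.eventually_configAt_eq (h : NonExplosive q e) (Λ : Finset V) (s : ℝ) :
    ∀ᶠ r in 𝓝[>] s, configAt q e Λ r = configAt q e Λ s := by
  have h1 : ∀ᶠ r in 𝓝[>] s, ∀ k ∈ {k | eventTime q e Λ (k + 1) ≤ ENNReal.ofReal (s + 1)},
      eventTime q e Λ (k + 1) ≤ ENNReal.ofReal r → eventTime q e Λ (k + 1) ≤ ENNReal.ofReal s := by
    rw [Filter.eventually_all_finite (h.finite_eventTime_le Λ (s + 1))]
    intro k _
    by_cases hk : eventTime q e Λ (k + 1) ≤ ENNReal.ofReal s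
    · exact Eventually.of_forall fun _ _ => hk
    · have : Tendsto ENNReal.ofReal (𝓝[>] s) (𝓝 (ENNReal.ofReal s)) :=
        ENNReal.continuous_ofReal.continuousAt.mono_left nhdsWithin_le_nhds
      filter_upwards [this.eventually (gt_mem_nhds (not_le.1 hk))] with r hr hr'
      exact absurd hr' (not_le.2 hr)
  have h2 : ∀ᶠ r in 𝓝[>] s, r ∈ Ioo s (s + 1) := Ioo_mem_nhdsGT (by linarith)
  filter_upwards [h1, h2] with r hr hr'
  unfold configAt
  congr 2
  ext k
  exact ⟨fun hk => hr k (le_trans hk (ENNReal.ofReal_le_ofReal hr'.2.le)) hk,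
    fun hk => le_trans hk (ENNReal.ofReal_le_ofReal hr'.1.le)⟩

/-! ### The full system -/

/-- The leader of a particle in the full system, with the histories compared at countably many
times. -/
def LedByRat (q : Params) (e : Env V) (t : ℝ) (u y : V) : Prop :=
  ∃ Λ₀ : Finset V, configAt q e Λ₀ t u = some y ∧
    ∀ Λ : Finset V, Λ₀ ⊆ Λ → ∀ r : ℚ,
      configAt q e Λ (min (max 0 r) t) u = configAt q e Λ₀ (min (max 0 r) t) u

/-- By right-continuity the state at `s < t` is seen at a rational just after `s`. The endpoint `s =
t` is reached by clamping a rational beyond it. -/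
theorem NonExplosive.ledBy_iff_ledByRat (h : NonExplosive q e) {t : ℝ} (ht : 0 ≤ t) (u y : V) :
    LedBy q e t u y ↔ LedByRat q e t u y := by
  refine exists_congr fun Λ₀ => and_congr_right fun _ => forall₂_congr fun Λ _ => ?_
  refine ⟨fun H r => H _ ⟨le_min (le_max_left _ _) ht, min_le_right _ _⟩, fun H s hs => ?_⟩
  rcases hs.2.eq_or_lt with rfl | hst
  · obtain ⟨r, hr⟩ := exists_rat_gt s
    simpa [max_eq_right (hs.1.trans hr.le), min_eq_right hr.le] using H r
  · obtain ⟨b, hb, hb'⟩ := (mem_nhdsGT_iff_exists_Ioo_subset).1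
      ((h.eventually_configAt_eq Λ s).and (h.eventually_configAt_eq Λ₀ s))
    obtain ⟨r, hr1, hr2⟩ := exists_rat_btwn (lt_min hst hb)
    have hH := H r
    rw [max_eq_right (hs.1.trans hr1.le), min_eq_left (hr2.le.trans (min_le_left _ _))] at hH
    obtain ⟨h1, h2⟩ := hb' ⟨hr1, hr2.trans_le (min_le_right _ _)⟩
    rw [← h1, ← h2, hH]

theorem LedBy.eventually {t : ℝ} (ht : 0 ≤ t) {u y : V} (h : LedBy q e t u y) :
    ∃ Λ₀, ∀ Λ : Finset V, Λ₀ ⊆ Λ → configAt q e Λ t u = some y := by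
  obtain ⟨Λ₀, h0, h1⟩ := h
  exact ⟨Λ₀, fun Λ hΛ => (h1 Λ hΛ t ⟨ht, le_rfl⟩).trans h0⟩

theorem LedBy.unique {t : ℝ} (ht : 0 ≤ t) {u y y' : V} (h : LedBy q e t u y)
    (h' : LedBy q e t u y') : y = y' := by
  classical
  obtain ⟨Λ, hΛ⟩ := h.eventually ht
  obtain ⟨Λ', hΛ'⟩ := h'.eventually ht
  simpa [hΛ (Λ ∪ Λ') Finset.subset_union_left] using hΛ' (Λ ∪ Λ') Finset.subset_union_right

theorem LedBy.isA_eq {t : ℝ} {u y : V} (h : LedBy q e t u y) : e.isA u = e.isA y :=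
  h.elim fun _ h => (isClustering_configAt _ _ _ _).isA _ _ h.1

/-- A particle that leads at time `t` has led itself at all earlier times, so its history is
constant in every large finite system and the stability clause is automatic. -/
theorem LedBy.leader (hq : NonExplosive q e) {t : ℝ} (ht : 0 ≤ t) {u y : V}
    (h : LedBy q e t u y) : LedBy q e t y y := by
  obtain ⟨Λ₀, hΛ₀⟩ := h.eventually ht
  have key : ∀ Λ : Finset V, Λ₀ ⊆ Λ → ∀ s ≤ t, configAt q e Λ s y = some y := fun Λ hΛ s hs =>
    (hq.precedes_configAt Λ hs y).2 ((isClustering_configAt _ _ _ _).leader _ _ (hΛ₀ Λ hΛ))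
  exact ⟨Λ₀, key Λ₀ subset_rfl t le_rfl, fun Λ hΛ s hs =>
    (key Λ hΛ s hs.2).trans (key Λ₀ subset_rfl s hs.2).symm⟩

theorem InSystem.anti (hq : NonExplosive q e) {s t : ℝ} (hst : s ≤ t) {u : V}
    (h : InSystem q e t u) : InSystem q e s u := by
  obtain ⟨y, Λ₀, h0, h1⟩ := h
  obtain ⟨z, hz⟩ : ∃ z, configAt q e Λ₀ s u = some z := by
    refine Option.ne_none_iff_exists'.1 fun hn => ?_
    simp [(hq.precedes_configAt Λ₀ hst u).1 hn] at h0
  exact ⟨z, Λ₀, hz, fun Λ hΛ r hr => h1 Λ hΛ r ⟨hr.1, hr.2.trans hst⟩⟩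

/-- A finite cluster of the full system lies inside one cluster of a sufficiently large finite
system: take the union of the sets that work for its members. -/
theorem encard_cluster_le {t : ℝ} (ht : 0 ≤ t) {y : V} (hy : e.isA y = true) {i : ℕ}
    (hi : {u | LedBy q e t u y}.encard = i) : (i : ℝ≥0∞) ≤ max 1 (2 * q.capA) := by
  classical
  have hfin : {u | LedBy q e t u y}.Finite := finite_of_encard_eq_coe hi
  choose! Λ hΛ using fun u (hu : u ∈ {u | LedBy q e t u y}) => LedBy.eventually ht hu
  set Λ' := hfin.toFinset.biUnion Λ
  have hsub : {u | LedBy q e t u y} ⊆ {u | configAt q e Λ' t u = some y} := fun u hu =>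
    hΛ u hu Λ' (Finset.subset_biUnion_of_mem Λ (hfin.mem_toFinset.2 hu))
  have hc := isClustering_configAt q e Λ' t
  have hle := ncard_le_ncard hsub (Λ'.finite_toSet.subset fun u hu => hc.mem u y hu)
  refine le_trans ?_ (hc.size_le y hy)
  rw [ncard_def, hi, ENat.toNat_natCast] at hle
  exact Nat.cast_le.2 hle

/-! ### Measurability -/

section Measurability

set_option linter.unusedSectionVars false

variable {V Ω : Type*} [MeasurableSpace Ω]

theorem encard_eq_tsum {α : Type*} (S : Set α) :
    (S.encard : ℝ≥0∞) = ∑' a, S.indicator 1 a := by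
  rw [← ENNReal.tsum_set_one, ← tsum_subtype]
  rfl

theorem measurable_encard {α : Type*} [Countable α] {S : Ω → Set α}
    (h : ∀ a, Measurable fun ω => a ∈ S ω) : Measurable fun ω => ((S ω).encard : ℝ≥0∞) := by
  simp_rw [encard_eq_tsum]
  refine Measurable.tsum fun a => ?_
  classical
  simp only [indicator_apply, Pi.one_apply]
  exact Measurable.ite (measurableSet_setOfPred.2 (h a)) measurable_const measurable_const

theorem measurable_ncard {α : Type*} [Countable α] {S : Ω → Set α}
    (h : ∀ a, Measurable fun ω => a ∈ S ω) : Measurable fun ω => (S ω).ncard := by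
  -- On an infinite set both sides are 0, since `toReal` sends `∞` to 0.
  have : ∀ ω, (S ω).ncard = ⌊((S ω).encard : ℝ≥0∞).toReal⌋₊ := fun ω => by
    rcases (S ω).finite_or_infinite with hf | hf
    · rw [← hf.cast_ncard_eq]
      simp
    · simp [hf.ncard, hf.encard_eq]
  simp_rw [this]
  exact Nat.measurable_floor.comp (measurable_encard h).ennreal_toReal

theorem measurable_prop_of_iff {p r : Ω → Prop} (h : ∀ ω, p ω ↔ r ω) (hr : Measurable r) :
    Measurable p := by
  rwa [show p = r from funext fun ω => propext (h ω)]

theorem measurable_eq_of_countable {α : Type*} [MeasurableSpace α] [DiscreteMeasurableSpace α]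
    [Countable α] {f g : Ω → α} (hf : Measurable f) (hg : Measurable g) :
    Measurable fun ω => f ω = g ω :=
  (measurable_of_countable fun p : α × α => p.1 = p.2).comp (hf.prodMk hg)

theorem measurable_le_prop {f g : Ω → ℝ≥0∞} (hf : Measurable f) (hg : Measurable g) :
    Measurable fun ω => f ω ≤ g ω :=
  measurableSet_setOfPred.1 (measurableSet_le hf hg)

/-- All the coordinates of the random environment `E` are measurable. -/
structure IsMeasurableEnv [MeasurableSpace V] (E : Ω → Env V) : Prop where
  isA : ∀ x, Measurable fun ω => (E ω).isA x
  path : ∀ x, Measurable fun ω => (E ω).path x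
  clock : ∀ x, Measurable fun ω => (E ω).clock x
  bravery : ∀ x, Measurable fun ω => (E ω).bravery x

variable [MeasurableSpace V] [DiscreteMeasurableSpace V] [Countable V]

theorem IsMeasurableEnv.comp {Ω' : Type*} [MeasurableSpace Ω'] {E : Ω → Env V}
    (hE : IsMeasurableEnv E) {f : Ω' → Ω} (hf : Measurable f) :
    IsMeasurableEnv fun ω => E (f ω) :=
  ⟨fun x => (hE.isA x).comp hf, fun x => (hE.path x).comp hf, fun x => (hE.clock x).comp hf,
    fun x => (hE.bravery x).comp hf⟩

/-- A random configuration. -/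
def IsMeasurableConfig (c : Ω → V → Option V) : Prop :=
  ∀ u o, Measurable fun ω => c ω u = o

variable {E : Ω → Env V} (q : Params)
theorem IsMeasurableConfig.size {c : Ω → V → Option V} (hc : IsMeasurableConfig c) (y : V) :
    Measurable fun ω => size (c ω) y :=
  measurable_ncard fun u => hc u (some y)

theorem IsMeasurableEnv.cap (hE : IsMeasurableEnv E) (y : V) : Measurable fun ω => cap q (E ω) y :=
  (measurable_of_countable fun b : Bool => if b then q.capA else q.capB).comp (hE.isA y)

theorem IsMeasurableEnv.rate (hE : IsMeasurableEnv E) (y : V) : Measurable fun ω => rate q (E ω) y :=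
  (measurable_of_countable fun b : Bool => if b then q.rateA else q.rateB).comp (hE.isA y)

theorem IsMeasurableEnv.ring (hE : IsMeasurableEnv E) (y : V) (n : ℕ) : Measurable fun ω => ring q (E ω) y n := by
  unfold DLACS.ring
  refine Measurable.div (Measurable.ennreal_ofReal ?_) (hE.rate q y).ennreal_ofReal
  exact Finset.measurable_sum _ fun k _ => (measurable_pi_apply k).comp (hE.clock y)

theorem IsMeasurableEnv.pos (hE : IsMeasurableEnv E) (y : V) {s : Ω → ℝ≥0∞} (hs : Measurable s) :
    Measurable fun ω => pos q (E ω) y (s ω) := by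
  have hN : Measurable fun ω => {n | DLACS.ring q (E ω) y n ≤ s ω}.ncard :=
    measurable_ncard fun n => measurable_le_prop (hE.ring q y n) hs
  have hp : Measurable fun a : ℕ × Ω => (E a.2).path y a.1 :=
    measurable_from_prod_countable_right fun k => (measurable_pi_apply k).comp (hE.path y)
  exact hp.comp (hN.prodMk measurable_id)

theorem IsMeasurableEnv.reacts (hE : IsMeasurableEnv E) {s : Ω → ℝ≥0∞} (hs : Measurable s) {c : Ω → V → Option V}
    (hc : IsMeasurableConfig c) (y z : V) :
    Measurable fun ω => Reacts q (E ω) (s ω) (c ω) y z := by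
  unfold Reacts
  refine (hc _ _).and <| (hc _ _).and <|
    (measurableSet_setOfPred.1 (measurableSet_lt (hE.bravery z) (hE.bravery y))).and <|
    (measurable_eq_of_countable (hE.pos q y hs) (hE.pos q z hs)).and <|
    (measurable_eq_of_countable (hE.isA y) (hE.isA z)).not.or <|
    measurable_le_prop ?_ (hE.cap q y)
  exact (measurable_of_countable fun n : ℕ => (n : ℝ≥0∞)).comp ((hc.size y).max (hc.size z))

theorem IsMeasurableEnv.isTopPair (hE : IsMeasurableEnv E) {s : Ω → ℝ≥0∞} (hs : Measurable s) {c : Ω → V → Option V}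
    (hc : IsMeasurableConfig c) (a : V × V) :
    Measurable fun ω => IsTopPair q (E ω) (s ω) (c ω) a := by
  unfold IsTopPair
  refine (hE.reacts q hs hc _ _).and <| Measurable.forall fun y => Measurable.forall fun z =>
    (hE.reacts q hs hc _ _).imp <| Measurable.or ?_ <| Measurable.and ?_ ?_
  · exact measurableSet_setOfPred.1 (measurableSet_lt (hE.bravery _) (hE.bravery _))
  · exact measurableSet_setOfPred.1 (measurableSet_eq_fun (hE.bravery _) (hE.bravery _))
  · exact measurableSet_setOfPred.1 (measurableSet_le (hE.bravery _) (hE.bravery _))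

theorem IsMeasurableEnv.merge (hE : IsMeasurableEnv E) {c : Ω → V → Option V} (hc : IsMeasurableConfig c) (y z : V) :
    IsMeasurableConfig fun ω => merge (E ω) (c ω) y z := by
  intro u o
  have h1 : Measurable fun ω => c ω u = some y ∨ c ω u = some z := (hc _ _).or (hc _ _)
  have h2 := measurable_eq_of_countable (hE.isA y) (hE.isA z)
  refine measurable_prop_of_iff (r := fun ω =>
    ((c ω u = some y ∨ c ω u = some z) ∧ (((E ω).isA y = (E ω).isA z ∧ some y = o) ∨
      (¬ (E ω).isA y = (E ω).isA z ∧ none = o))) ∨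
      (¬ (c ω u = some y ∨ c ω u = some z) ∧ c ω u = o)) (fun ω => ?_) ?_
  · change DLACS.merge (E ω) (c ω) y z u = o ↔ _
    unfold DLACS.merge
    split_ifs with h h' <;> simp [*]
  · exact (h1.and ((h2.and measurable_const).or (h2.not.and measurable_const))).or
      (h1.not.and (hc _ _))

/-- Uniqueness of the top pair allows the choice in `reactStep` to be replaced by an existential
over countably many pairs. -/
theorem IsMeasurableEnv.reactStep (hE : IsMeasurableEnv E) {s : Ω → ℝ≥0∞} (hs : Measurable s) {c : Ω → V → Option V}
    (hc : IsMeasurableConfig c) :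
    IsMeasurableConfig fun ω => reactStep q (E ω) (s ω) (c ω) := by
  intro u o
  have h1 : ∀ a : V × V, Measurable fun ω => IsTopPair q (E ω) (s ω) (c ω) a ∧
      ∀ b, IsTopPair q (E ω) (s ω) (c ω) b → b = a := fun a =>
    (hE.isTopPair q hs hc a).and <| Measurable.forall fun b =>
      (hE.isTopPair q hs hc b).imp measurable_const
  refine measurable_prop_of_iff (r := fun ω =>
    (∃ a : V × V, (IsTopPair q (E ω) (s ω) (c ω) a ∧
      ∀ b, IsTopPair q (E ω) (s ω) (c ω) b → b = a) ∧
        DLACS.merge (E ω) (c ω) a.1 a.2 u = o) ∨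
      (¬ (∃ a : V × V, IsTopPair q (E ω) (s ω) (c ω) a ∧
        ∀ b, IsTopPair q (E ω) (s ω) (c ω) b → b = a) ∧ c ω u = o)) (fun ω => ?_) ?_
  · change DLACS.reactStep q (E ω) (s ω) (c ω) u = o ↔ _
    unfold DLACS.reactStep
    split_ifs with h
    · constructor
      · exact fun h' => Or.inl ⟨_, h.choose_spec, h'⟩
      · rintro (⟨a, ha, h'⟩ | ⟨h', -⟩)
        · rwa [ha.2 _ h.choose_spec.1]
        · exact absurd h h'
    · constructor
      · exact fun h' => Or.inr ⟨h, h'⟩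
      · rintro (⟨a, ha, -⟩ | ⟨-, h'⟩)
        · exact absurd ⟨a, ha⟩ h
        · exact h'
  · exact (Measurable.exists fun a => (h1 a).and (hE.merge hc a.1 a.2 u o)).or
      ((Measurable.exists h1).not.and (hc _ _))

theorem IsMeasurableEnv.eventTime (hE : IsMeasurableEnv E) (Λ : Finset V) (k : ℕ) :
    Measurable fun ω => eventTime q (E ω) Λ k := by
  induction k with
  | zero => exact measurable_const
  | succ k ih =>
    classical
    -- The infimum over a random set becomes a countable infimum once excluded rings are given the
    -- value `∞`.
    have : ∀ ω, DLACS.eventTime q (E ω) Λ (k + 1) =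
        ⨅ (y : V) (_ : y ∈ Λ) (n : ℕ), if DLACS.eventTime q (E ω) Λ k < DLACS.ring q (E ω) y n
          then DLACS.ring q (E ω) y n else ∞ := by
      intro ω
      simp only [DLACS.eventTime, nextRing]
      refine le_antisymm (le_iInf₂ fun y hy => le_iInf fun n => ?_) (le_sInf ?_)
      · split_ifs with h
        · exact sInf_le ⟨h, y, hy, n, rfl⟩
        · exact le_top
      · rintro _ ⟨h, y, hy, n, rfl⟩
        refine (iInf₂_le y hy).trans ((iInf_le _ n).trans ?_)
        rw [if_pos h]
    simp_rw [this]
    exact Measurable.iInf fun y => Measurable.iInf fun _ => Measurable.iInf fun n =>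
      Measurable.ite (measurableSet_lt ih (hE.ring q y n)) (hE.ring q y n) measurable_const

theorem IsMeasurableEnv.config (hE : IsMeasurableEnv E) (Λ : Finset V) (k : ℕ) :
    IsMeasurableConfig fun ω => config q (E ω) Λ k := by
  induction k with
  | zero =>
    intro u o
    simp only [DLACS.config]
    exact measurable_const
  | succ k ih =>
    simp only [DLACS.config]
    generalize Λ.card = n
    induction n with
    | zero => exact ih
    | succ n ihn =>
      simp only [Function.iterate_succ_apply']
      exact hE.reactStep q (hE.eventTime q Λ (k + 1)) ihn

/-- The time may be random, so that on `Ω × ℝ` this gives the joint measurability that Tonelli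
requires. -/
theorem IsMeasurableEnv.configAt (hE : IsMeasurableEnv E) (Λ : Finset V) {t : Ω → ℝ} (ht : Measurable t) :
    IsMeasurableConfig fun ω => configAt q (E ω) Λ (t ω) := by
  intro u o
  have hN : Measurable fun ω => {k | DLACS.eventTime q (E ω) Λ (k + 1)
      ≤ ENNReal.ofReal (t ω)}.ncard :=
    measurable_ncard fun k => measurable_le_prop (hE.eventTime q Λ _) ht.ennreal_ofReal
  refine measurable_prop_of_iff (r := fun ω => ∃ k : ℕ, {k | DLACS.eventTime q (E ω) Λ (k + 1)
      ≤ ENNReal.ofReal (t ω)}.ncard = k ∧ DLACS.config q (E ω) Λ k u = o) (fun ω => ?_) ?_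
  · simp [DLACS.configAt]
  · exact Measurable.exists fun k => (measurable_eq_of_countable hN measurable_const).and
      (hE.config q Λ k u o)

theorem IsMeasurableEnv.ledByRat (hE : IsMeasurableEnv E) {t : Ω → ℝ} (ht : Measurable t) (u y : V) :
    Measurable fun ω => LedByRat q (E ω) (t ω) u y := by
  refine Measurable.exists fun Λ₀ => (hE.configAt q Λ₀ ht u _).and <|
    Measurable.forall fun Λ => measurable_const.imp <| Measurable.forall fun r => ?_
  have hr : Measurable fun ω => min (max 0 (r : ℝ)) (t ω) := measurable_const.min ht
  refine measurable_prop_of_iff (r := fun ω => ∃ o : Option V,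
    DLACS.configAt q (E ω) Λ (min (max 0 r) (t ω)) u = o ∧
      DLACS.configAt q (E ω) Λ₀ (min (max 0 r) (t ω)) u = o) (fun ω => ?_) ?_
  · simp [eq_comm]
  · exact Measurable.exists fun o => (hE.configAt q Λ hr u o).and (hE.configAt q Λ₀ hr u o)

end Measurability

/-! ### Relabelling of the vertices -/

section Relabel

variable {V : Type*} (q : Params) (σ : V ≃ V) (e : Env V)

/-- The environment `e` carried along `σ`. -/
def Env.relabel (σ : V ≃ V) (e : Env V) : Env V where
  isA x := e.isA (σ.symm x)
  path x n := σ (e.path (σ.symm x) n)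
  clock x := e.clock (σ.symm x)
  bravery x := e.bravery (σ.symm x)

/-- The configuration `c` carried along `σ`. -/
def relabelConfig (σ : V ≃ V) (c : V → Option V) : V → Option V :=
  fun x => (c (σ.symm x)).map σ

@[simp] theorem isA_relabel (y : V) : (e.relabel σ).isA (σ y) = e.isA y := by
  simp [Env.relabel]

@[simp] theorem bravery_relabel (y : V) : (e.relabel σ).bravery (σ y) = e.bravery y := by
  simp [Env.relabel]

@[simp] theorem cap_relabel (y : V) : cap q (e.relabel σ) (σ y) = cap q e y := by
  simp [cap]

@[simp] theorem ring_relabel (y : V) (n : ℕ) :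
    ring q (e.relabel σ) (σ y) n = ring q e y n := by
  simp [ring, rate, Env.relabel]

@[simp] theorem pos_relabel (y : V) (s : ℝ≥0∞) :
    pos q (e.relabel σ) (σ y) s = σ (pos q e y s) := by
  simp [pos, Env.relabel, ring, rate]

theorem relabelConfig_apply (c : V → Option V) (u : V) :
    relabelConfig σ c (σ u) = (c u).map σ := by
  simp [relabelConfig]

@[simp] theorem relabelConfig_eq_some (c : V → Option V) (u y : V) :
    relabelConfig σ c (σ u) = some (σ y) ↔ c u = some y := by
  simp [relabelConfig]

@[simp] theorem size_relabelConfig (c : V → Option V) (y : V) :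
    size (relabelConfig σ c) (σ y) = size c y := by
  have : {u | relabelConfig σ c u = some (σ y)} = σ '' {u | c u = some y} := by
    ext u
    obtain ⟨u, rfl⟩ := σ.surjective u
    simp
  rw [size, this, ncard_image_of_injective _ σ.injective, size]

@[simp] theorem reacts_relabel (s : ℝ≥0∞) (c : V → Option V) (y z : V) :
    Reacts q (e.relabel σ) s (relabelConfig σ c) (σ y) (σ z) ↔ Reacts q e s c y z := by
  simp [Reacts]

theorem isTopPair_relabel (s : ℝ≥0∞) (c : V → Option V) (a : V × V) :
    IsTopPair q (e.relabel σ) s (relabelConfig σ c) (σ.prodCongr σ a) ↔ IsTopPair q e s c a := by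
  refine and_congr (reacts_relabel q σ e s c _ _) ?_
  rw [← σ.forall_congr_right]
  refine forall_congr' fun y => ?_
  rw [← σ.forall_congr_right]
  simp

theorem merge_relabel (c : V → Option V) (y z : V) :
    merge (e.relabel σ) (relabelConfig σ c) (σ y) (σ z) = relabelConfig σ (merge e c y z) := by
  ext1 u
  obtain ⟨u, rfl⟩ := σ.surjective u
  rw [relabelConfig_apply]
  have hiff : (relabelConfig σ c (σ u) = some (σ y) ∨ relabelConfig σ c (σ u) = some (σ z)) ↔
      (c u = some y ∨ c u = some z) := by simp only [relabelConfig_eq_some]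
  by_cases h : c u = some y ∨ c u = some z
  · rw [merge, if_pos (hiff.2 h), merge, if_pos h]
    simp only [isA_relabel]
    split_ifs <;> rfl
  · rw [merge, if_neg (mt hiff.1 h), merge, if_neg h, relabelConfig_apply]

theorem reactStep_eq_merge {q : Params} {e : Env V} {s : ℝ≥0∞} {c : V → Option V} {a : V × V}
    (ha : IsTopPair q e s c a) (h : ∀ b, IsTopPair q e s c b → b = a) :
    reactStep q e s c = merge e c a.1 a.2 := by
  have hex : ∃! a, IsTopPair q e s c a := ⟨a, ha, h⟩
  rw [reactStep, dif_pos hex, h _ hex.choose_spec.1]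

/-- Equivariance holds because a reaction takes place only when the top pair is unique, so no
arbitrary choice can break the symmetry. -/
theorem reactStep_relabel (s : ℝ≥0∞) (c : V → Option V) :
    reactStep q (e.relabel σ) s (relabelConfig σ c) = relabelConfig σ (reactStep q e s c) := by
  by_cases h : ∃! a, IsTopPair q e s c a
  · obtain ⟨a, ha, hu⟩ := h
    rw [reactStep_eq_merge ha hu, ← merge_relabel]
    refine reactStep_eq_merge (a := σ.prodCongr σ a) ((isTopPair_relabel q σ e s c a).2 ha) ?_
    intro b hb
    obtain ⟨b, rfl⟩ := (σ.prodCongr σ).surjective b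
    rw [hu b ((isTopPair_relabel q σ e s c b).1 hb)]
  · have h' : ¬ ∃! a, IsTopPair q (e.relabel σ) s (relabelConfig σ c) a := by
      rw [← (σ.prodCongr σ).existsUnique_congr_right]
      simpa only [isTopPair_relabel] using h
    rw [reactStep, dif_neg h', reactStep, dif_neg h]

@[simp] theorem nextRing_relabel (Λ : Finset V) (s : ℝ≥0∞) :
    nextRing q (e.relabel σ) (Λ.map σ.toEmbedding) s = nextRing q e Λ s := by
  unfold nextRing
  congr 1
  ext r
  refine and_congr_right fun _ => ?_
  simp only [Finset.mem_map]
  constructor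
  · rintro ⟨_, ⟨y, hy, rfl⟩, n, rfl⟩
    exact ⟨y, hy, n, (ring_relabel q σ e y n).symm⟩
  · rintro ⟨y, hy, n, rfl⟩
    exact ⟨σ y, ⟨y, hy, rfl⟩, n, ring_relabel q σ e y n⟩

@[simp] theorem eventTime_relabel (Λ : Finset V) (k : ℕ) :
    eventTime q (e.relabel σ) (Λ.map σ.toEmbedding) k = eventTime q e Λ k := by
  induction k with
  | zero => rfl
  | succ k ih => simp [eventTime, ih]

theorem config_relabel (Λ : Finset V) (k : ℕ) :
    config q (e.relabel σ) (Λ.map σ.toEmbedding) k = relabelConfig σ (config q e Λ k) := by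
  induction k with
  | zero =>
    ext1 u
    obtain ⟨u, rfl⟩ := σ.surjective u
    by_cases hu : u ∈ Λ <;> simp [config, relabelConfig, hu]
  | succ k ih =>
    simp only [config, Finset.card_map, eventTime_relabel, ih]
    generalize Λ.card = n
    induction n with
    | zero => rfl
    | succ n ihn => rw [Function.iterate_succ_apply', ihn, reactStep_relabel,
        Function.iterate_succ_apply']

theorem configAt_relabel (Λ : Finset V) (t : ℝ) (u : V) :
    configAt q (e.relabel σ) (Λ.map σ.toEmbedding) t (σ u) = (configAt q e Λ t u).map σ := by
  simp [configAt, config_relabel, relabelConfig]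

theorem ledByRat_relabel (t : ℝ) (u y : V) :
    LedByRat q (e.relabel σ) t (σ u) (σ y) ↔ LedByRat q e t u y := by
  have hsurj : Function.Surjective fun Λ : Finset V => Λ.map σ.toEmbedding := fun Λ =>
    ⟨Λ.map σ.symm.toEmbedding, by simp [Finset.map_map]⟩
  unfold LedByRat
  rw [hsurj.exists]
  refine exists_congr fun Λ₀ => and_congr ?_ ?_
  · rw [configAt_relabel, Option.map_eq_some_iff]
    simp
  · rw [hsurj.forall]
    simp only [Finset.map_subset_map, configAt_relabel, (Option.map_injective σ.injective).eq_iff]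

end Relabel

/-! ### Mass transport -/

section MassTransport

variable {V : Type*} {G : SimpleGraph V} {Γ : Subgroup (G ≃g G)}

/-- The orbit of the pair `(u, v)` under `Γ`. -/
def pairOrbit (Γ : Subgroup (G ≃g G)) (u v : V) : Set (V × V) :=
  {a | ∃ φ ∈ Γ, φ u = a.1 ∧ φ v = a.2}

theorem pairOrbit_eq_iff {u v u' v' : V} :
    pairOrbit Γ u v = pairOrbit Γ u' v' ↔ ∃ φ ∈ Γ, φ u = u' ∧ φ v = v' := by
  constructor
  · intro h
    have : (u', v') ∈ pairOrbit Γ u v := h ▸ ⟨1, Γ.one_mem, rfl, rfl⟩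
    exact this
  · rintro ⟨φ, hφ, rfl, rfl⟩
    ext a
    constructor
    · rintro ⟨ψ, hψ, h1, h2⟩
      refine ⟨ψ * φ⁻¹, Γ.mul_mem hψ (Γ.inv_mem hφ), ?_, ?_⟩
      · rw [← h1]; exact congrArg ψ (φ.symm_apply_apply u)
      · rw [← h2]; exact congrArg ψ (φ.symm_apply_apply v)
    · rintro ⟨ψ, hψ, h1, h2⟩
      exact ⟨ψ * φ, Γ.mul_mem hψ hφ, h1, h2⟩

theorem fiber_pairOrbit_left (o v : V) :
    {x | pairOrbit Γ o x = pairOrbit Γ o v} = stabOrbit Γ o v := by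
  ext x
  rw [mem_ofPred_eq, eq_comm, pairOrbit_eq_iff]
  rfl

theorem fiber_pairOrbit_right (o v : V) :
    {x | pairOrbit Γ x o = pairOrbit Γ v o} = stabOrbit Γ o v := by
  ext x
  rw [mem_ofPred_eq, eq_comm, pairOrbit_eq_iff]
  simp only [and_comm]
  rfl

/-- Conjugation by `φ` carries the stabilizer of `u` onto that of `φ u`. -/
theorem encard_stabOrbit_map {φ : G ≃g G} (hφ : φ ∈ Γ) (u v : V) :
    (stabOrbit Γ (φ u) (φ v)).encard = (stabOrbit Γ u v).encard := by
  have : stabOrbit Γ (φ u) (φ v) = φ '' stabOrbit Γ u v := by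
    ext w
    constructor
    · rintro ⟨ψ, hψ, h1, h2⟩
      refine ⟨φ⁻¹ w, ⟨φ⁻¹ * ψ * φ, Γ.mul_mem (Γ.mul_mem (Γ.inv_mem hφ) hψ) hφ, ?_, ?_⟩,
        φ.apply_symm_apply w⟩
      · exact (congrArg φ.symm h1).trans (φ.symm_apply_apply u)
      · exact congrArg φ.symm h2
    · rintro ⟨_, ⟨ψ, hψ, h1, rfl⟩, rfl⟩
      refine ⟨φ * ψ * φ⁻¹, Γ.mul_mem (Γ.mul_mem hφ hψ) (Γ.inv_mem hφ), ?_, ?_⟩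
      · exact (congrArg (fun x => φ (ψ x)) (φ.symm_apply_apply u)).trans (congrArg φ h1)
      · exact congrArg (fun x => φ (ψ x)) (φ.symm_apply_apply v)
  rw [this, φ.injective.encard_image]

/-- The mass transport principle. -/
theorem tsum_left_eq_tsum_right (htrans : IsTransitive Γ) (hunim : IsUnimodular Γ)
    (F : V → V → ℝ≥0∞) (hF : ∀ φ ∈ Γ, ∀ u v, F (φ u) (φ v) = F u v) (o : V) :
    ∑' x, F o x = ∑' x, F x o := by
  -- `F` is constant on orbits of pairs, so it suffices to match, orbit by orbit, the `x` with `(o,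
  -- x)` in the orbit and the `x` with `(x, o)` in it. If `ψ v = o`, these sets are the stabilizer
  -- orbits of `v` and of `ψ o` at `o`: applying `ψ` and then unimodularity gives `|Γ(o,o) v| = |Γ(ψ
  -- o,ψ o) o| = |Γ(o,o) ψ o|`.
  have key : ∀ c : Set (V × V),
      Nonempty ({x // pairOrbit Γ o x = c} ≃ {x // pairOrbit Γ x o = c}) := by
    intro c
    by_cases hc : ∃ v, pairOrbit Γ o v = c
    · obtain ⟨v, rfl⟩ := hc
      obtain ⟨ψ, hψ, hψv⟩ := htrans v o
      have hv : pairOrbit Γ o v = pairOrbit Γ (ψ o) o :=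
        pairOrbit_eq_iff.2 ⟨ψ, hψ, rfl, hψv⟩
      have hcard : (stabOrbit Γ o v).encard = (stabOrbit Γ o (ψ o)).encard := by
        rw [← encard_stabOrbit_map hψ, hψv, (hunim _ _).2]
      have h1 : Finite {x // pairOrbit Γ o x = pairOrbit Γ o v} := by
        have := (hunim o v).1
        rwa [← fiber_pairOrbit_left] at this
      have h2 : Finite {x // pairOrbit Γ x o = pairOrbit Γ o v} := by
        have := (hunim o (ψ o)).1
        rwa [← fiber_pairOrbit_right, ← hv] at this
      rw [← fiber_pairOrbit_left, ← fiber_pairOrbit_right, ← hv] at hcard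
      exact Finite.card_eq.1 (congrArg ENat.toNat hcard)
    · have h1 : IsEmpty {x // pairOrbit Γ o x = c} := ⟨fun x => hc ⟨x.1, x.2⟩⟩
      have h2 : IsEmpty {x // pairOrbit Γ x o = c} := by
        refine ⟨fun x => ?_⟩
        obtain ⟨ψ, hψ, hx⟩ := htrans x.1 o
        exact hc ⟨ψ o, (pairOrbit_eq_iff.2 ⟨ψ, hψ, hx, rfl⟩).symm.trans x.2⟩
      exact ⟨Equiv.equivOfIsEmpty _ _⟩
  let ε := fun c => (key c).some
  -- The bijections of the fibres glue to a permutation of the vertices, along which the second sum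
  -- is reindexed.
  rw [← (Equiv.ofFiberEquiv ε).tsum_eq fun x => F x o]
  refine tsum_congr fun x => ?_
  obtain ⟨φ, hφ, h1, h2⟩ := pairOrbit_eq_iff.1 (Equiv.ofFiberEquiv_map ε x).symm
  rw [← hF φ hφ, h1, h2]

/-- Balls around a vertex are finite by local finiteness and exhaust a connected graph. -/
theorem _root_.SimpleGraph.Connected.countable [G.LocallyFinite] (hG : G.Connected) :
    Countable V := by
  classical
  obtain ⟨o⟩ := hG.nonempty
  let B : ℕ → Finset V := fun n => n.rec {o} fun _ S => S ∪ S.biUnion fun v => G.neighborFinset v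
  have hB : ∀ v, ∃ n, v ∈ B n := by
    intro v
    have := (SimpleGraph.reachable_iff_reflTransGen o v).1 (hG.preconnected o v)
    induction this with
    | refl => exact ⟨0, Finset.mem_singleton_self o⟩
    | @tail a b _ hab ih =>
      obtain ⟨n, hn⟩ := ih
      refine ⟨n + 1, Finset.mem_union_right _ (Finset.mem_biUnion.2 ⟨a, hn, ?_⟩)⟩
      simpa using hab
  rw [← countable_univ_iff]
  refine (countable_iUnion fun n => (B n).countable_toSet).mono fun v _ => ?_
  simpa using hB v

end MassTransport

/-! ### The law of the environment -/

section Law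

variable {V : Type*}

theorem measurableSet_cylinder [MeasurableSpace V] [DiscreteMeasurableSpace V] (n : ℕ)
    (s : ℕ → V) : MeasurableSet {f : ℕ → V | ∀ k ≤ n, f k = s k} := by
  simp only [ofPred_forall]
  exact MeasurableSet.iInter fun k => MeasurableSet.iInter fun _ =>
    (measurable_pi_apply k : Measurable fun f : ℕ → V => f k) (measurableSet_singleton (s k))

/-- Probability measures on sequences in a countable set agree if they agree on cylinders. -/
theorem ext_of_cylinders [MeasurableSpace V] [DiscreteMeasurableSpace V] [Countable V]
    {μ ν : Measure (ℕ → V)} [IsProbabilityMeasure μ] [IsProbabilityMeasure ν]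
    (h : ∀ (n : ℕ) (s : ℕ → V), μ {f | ∀ k ≤ n, f k = s k} = ν {f | ∀ k ≤ n, f k = s k}) :
    μ = ν := by
  let C : Set (Set (ℕ → V)) := {A | ∃ (n : ℕ) (s : ℕ → V), A = {f | ∀ k ≤ n, f k = s k}}
  refine ext_of_generate_finite C (le_antisymm ?_ ?_) ?_ ?_ (by simp)
  · refine iSup_le fun k => ?_
    rintro _ ⟨B, -, rfl⟩
    -- An event about coordinate `k` is a countable union of cylinders, one for each word of length
    -- `k + 1` ending in `B`. The reduction modulo `k + 1` in `Fin.ofNat` does nothing for `j ≤ k`.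
    have hB : (fun f : ℕ → V => f k) ⁻¹' B = ⋃ s : {s : Fin (k + 1) → V // s (Fin.last k) ∈ B},
        {f | ∀ j ≤ k, f j = s.1 (Fin.ofNat (k + 1) j)} := by
      ext f
      simp only [mem_preimage, mem_iUnion, mem_ofPred_eq]
      constructor
      · refine fun hf => ⟨⟨fun j => f j, by simpa using hf⟩, fun j hj => ?_⟩
        simp [Nat.mod_eq_of_lt (Nat.lt_succ_of_le hj)]
      · rintro ⟨⟨s, hs⟩, h⟩
        rw [h k le_rfl]
        convert hs
        simp
    rw [hB]
    exact MeasurableSet.iUnion fun s => MeasurableSpace.measurableSet_generateFrom ⟨k, _, rfl⟩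
  · refine MeasurableSpace.generateFrom_le ?_
    rintro _ ⟨n, s, rfl⟩
    exact measurableSet_cylinder n s
  -- Two cylinders with a common point `f` intersect in the cylinder of `f` of the greater length.
  · rintro _ ⟨n, s, rfl⟩ _ ⟨m, s', rfl⟩ ⟨f, hf, hf'⟩
    refine ⟨max n m, f, ?_⟩
    ext g
    simp only [mem_inter_iff, mem_ofPred_eq, le_max_iff]
    constructor
    · rintro ⟨h1, h2⟩ k (hk | hk)
      exacts [(h1 k hk).trans (hf k hk).symm, (h2 k hk).trans (hf' k hk).symm]
    · exact fun h1 => ⟨fun k hk => (h1 k (Or.inl hk)).trans (hf k hk),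
        fun k hk => (h1 k (Or.inr hk)).trans (hf' k hk)⟩
  · rintro _ ⟨n, s, rfl⟩
    exact h n s

/-- The data attached to each of the sites. -/
def Env.sites (e : Env V) : V → Bool × (ℕ → V) × (ℕ → ℝ) × ℝ :=
  fun x => (e.isA x, e.path x, e.clock x, e.bravery x)

/-- The environment with given data at each site. -/
def Env.ofSites (z : V → Bool × (ℕ → V) × (ℕ → ℝ) × ℝ) : Env V where
  isA x := (z x).1
  path x := (z x).2.1
  clock x := (z x).2.2.1
  bravery x := (z x).2.2.2

variable [MeasurableSpace V]

theorem isMeasurableEnv_ofSites : IsMeasurableEnv (Env.ofSites (V := V)) :=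
  ⟨fun x => (measurable_pi_apply x).fst, fun x => (measurable_pi_apply x).snd.fst,
    fun x => (measurable_pi_apply x).snd.snd.fst, fun x => (measurable_pi_apply x).snd.snd.snd⟩

variable {Ω : Type*} [MeasurableSpace Ω] {P : Measure Ω} {E : Ω → Env V}
  {K : V → V → ℝ≥0} {p : ℝ}

theorem IsRandomEnv.isMeasurableEnv (hE : IsRandomEnv K p P E) : IsMeasurableEnv E :=
  ⟨hE.measurable_isA, hE.measurable_path, hE.measurable_clock, hE.measurable_bravery⟩

theorem IsRandomEnv.map_clock_eq [IsProbabilityMeasure P] (hE : IsRandomEnv K p P E) (x y : V) :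
    P.map (fun ω => (E ω).clock x) = P.map (fun ω => (E ω).clock y) := by
  have h : ∀ x, P.map (fun ω n => (E ω).clock x n)
      = Measure.infinitePi fun _ : ℕ => expMeasure 1 := fun x => by
    have := (iIndepFun_iff_map_fun_eq_infinitePi_map
      fun n => (measurable_pi_apply n).comp (hE.measurable_clock x)).1 (hE.indep_clock x)
    refine this.trans ?_
    congr 1
    exact funext fun n => hE.law_clock x n
  exact (h x).trans (h y).symm

theorem IsRandomEnv.map_isA_eq [IsProbabilityMeasure P] (hE : IsRandomEnv K p P E) (x y : V) :
    P.map (fun ω => (E ω).isA x) = P.map (fun ω => (E ω).isA y) := by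
  have htrue : ∀ x, P.map (fun ω => (E ω).isA x) {true} = ENNReal.ofReal p := fun x => by
    rw [Measure.map_apply (hE.measurable_isA x) (measurableSet_singleton _), ← hE.law_isA x]
    rfl
  have hfalse : ∀ x, P.map (fun ω => (E ω).isA x) {false} = 1 - ENNReal.ofReal p := fun x => by
    have := Measure.isProbabilityMeasure_map (μ := P) (hE.measurable_isA x).aemeasurable
    rw [← htrue x, ← prob_compl_eq_one_sub (measurableSet_singleton _)]
    congr 1
    ext b
    simp
  refine Measure.ext_of_singleton fun b => ?_
  cases b
  · rw [hfalse, hfalse]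
  · rw [htrue, htrue]

variable [DiscreteMeasurableSpace V] [Countable V]

/-- Cylinder probabilities are products of `K` along the word, which `σ` preserves; words with the
wrong starting point have probability zero on both sides. -/
theorem IsRandomEnv.map_path_eq [IsProbabilityMeasure P] (hE : IsRandomEnv K p P E) (σ : V ≃ V)
    (hσ : ∀ u v, K u v = K (σ u) (σ v)) (x : V) :
    P.map (fun ω n => σ ((E ω).path x n)) = P.map (fun ω => (E ω).path (σ x)) := by
  have hm : Measurable fun ω n => σ ((E ω).path x n) :=
    measurable_pi_lambda _ fun n => (measurable_of_countable σ).comp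
      ((measurable_pi_apply n).comp (hE.measurable_path x))
  have := Measure.isProbabilityMeasure_map (μ := P) hm.aemeasurable
  have := Measure.isProbabilityMeasure_map (μ := P) (hE.measurable_path (σ x)).aemeasurable
  have hzero : ∀ (y : V) (n : ℕ) (s : ℕ → V), s 0 ≠ y →
      P {ω | ∀ k ≤ n, (E ω).path y k = s k} = 0 := by
    intro y n s hs
    refine measure_mono_null (fun ω hω => ?_) (ae_iff.1 (hE.law_start y))
    exact fun h0 => hs ((hω 0 (Nat.zero_le n)).symm.trans h0)
  refine ext_of_cylinders fun n s => ?_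
  rw [Measure.map_apply hm (measurableSet_cylinder n s), Measure.map_apply (hE.measurable_path _) (measurableSet_cylinder n s)]
  have hset : (fun ω n => σ ((E ω).path x n)) ⁻¹' {f : ℕ → V | ∀ k ≤ n, f k = s k}
      = {ω | ∀ k ≤ n, (E ω).path x k = σ.symm (s k)} := by
    ext ω
    simp [Equiv.eq_symm_apply]
  rw [hset]
  change _ = P {ω | ∀ k ≤ n, (E ω).path (σ x) k = s k}
  by_cases hs : s 0 = σ x
  · rw [hE.law_path x n (fun k => σ.symm (s k)) (by simp [hs]), hE.law_path (σ x) n s hs]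
    refine Finset.prod_congr rfl fun k _ => ?_
    rw [hσ, σ.apply_symm_apply, σ.apply_symm_apply]
  · rw [hzero _ _ _ hs, hzero]
    exact fun h => hs (by simp [← h])

/-- A symmetry of the kernel preserves the law of the environment. -/
theorem IsRandomEnv.map_sites_relabel [IsProbabilityMeasure P] (hE : IsRandomEnv K p P E)
    (σ : V ≃ V) (hσ : ∀ u v, K u v = K (σ u) (σ v)) :
    P.map (fun ω => ((E ω).relabel σ).sites) = P.map (fun ω => (E ω).sites) := by
  have hmE := hE.isMeasurableEnv
  let g : Bool × (ℕ → V) × (ℕ → ℝ) × ℝ → Bool × (ℕ → V) × (ℕ → ℝ) × ℝ :=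
    fun a => (a.1, fun n => σ (a.2.1 n), a.2.2.1, a.2.2.2)
  have hcomp : Measurable fun (f : ℕ → V) n => σ (f n) :=
    measurable_pi_lambda _ fun n => (measurable_of_countable σ).comp (measurable_pi_apply n)
  have hg : Measurable g :=
    measurable_fst.prodMk ((hcomp.comp measurable_snd.fst).prodMk
      (measurable_snd.snd.fst.prodMk measurable_snd.snd.snd))
  have hsite : ∀ x, Measurable fun ω => (E ω).sites x := fun x =>
    (hmE.isA x).prodMk ((hmE.path x).prodMk ((hmE.clock x).prodMk (hmE.bravery x)))
  have hsite' : ∀ x, Measurable fun ω => ((E ω).relabel σ).sites x := fun x =>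
    hg.comp (hsite (σ.symm x))
  have hind : iIndepFun (fun x ω => (E ω).sites x) P := hE.indep_sites
  have hind' : iIndepFun (fun x ω => ((E ω).relabel σ).sites x) P :=
    (hind.precomp σ.symm.injective).comp (fun _ => g) fun _ => hg
  have h1 := (iIndepFun_iff_map_fun_eq_infinitePi_map hsite).1 hind
  have h2 := (iIndepFun_iff_map_fun_eq_infinitePi_map hsite').1 hind'
  -- By independence both laws are products over sites, so only the one-site marginals need
  -- comparing; each is a product of the laws of type, path, clock and bravery.
  refine h2.trans (Eq.trans ?_ h1.symm)
  congr 1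
  ext1 x
  obtain ⟨y, rfl⟩ := σ.surjective x
  have hmp : Measurable fun ω n => σ ((E ω).path y n) := hcomp.comp (hmE.path y)
  have hfst : ∀ ω, ((E ω).relabel σ).sites (σ y) =
      ((E ω).isA y, (fun n => σ ((E ω).path y n)), (E ω).clock y, (E ω).bravery y) := fun ω => by
    simp [Env.sites, Env.relabel]
  simp_rw [hfst]
  have e1 := (indepFun_iff_map_prod_eq_prod_map_map (hmE.isA y).aemeasurable
    (hmp.prodMk ((hmE.clock y).prodMk (hmE.bravery y))).aemeasurable).1
      ((hE.indep_isA y).comp measurable_id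
        ((hcomp.comp measurable_fst).prodMk measurable_snd))
  have e2 := (indepFun_iff_map_prod_eq_prod_map_map hmp.aemeasurable
    ((hmE.clock y).prodMk (hmE.bravery y)).aemeasurable).1
      ((hE.indep_path y).comp hcomp measurable_id)
  have e3 := fun y => (indepFun_iff_map_prod_eq_prod_map_map (hmE.clock y).aemeasurable
    (hmE.bravery y).aemeasurable).1 (hE.indep_clock_bravery y)
  have e4 := (indepFun_iff_map_prod_eq_prod_map_map (hmE.isA (σ y)).aemeasurable
    ((hmE.path _).prodMk ((hmE.clock _).prodMk (hmE.bravery _))).aemeasurable).1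
      (hE.indep_isA (σ y))
  have e5 := (indepFun_iff_map_prod_eq_prod_map_map (hmE.path (σ y)).aemeasurable
    ((hmE.clock _).prodMk (hmE.bravery _)).aemeasurable).1 (hE.indep_path (σ y))
  change _ = P.map (fun ω => ((E ω).isA (σ y), (E ω).path (σ y), (E ω).clock (σ y),
    (E ω).bravery (σ y)))
  rw [e1, e2, e3, e4, e5, e3, hE.map_isA_eq y (σ y), hE.map_path_eq σ hσ y,
    hE.map_clock_eq y (σ y), hE.law_bravery, hE.law_bravery]

theorem IsRandomEnv.measure_relabel [IsProbabilityMeasure P] (hE : IsRandomEnv K p P E)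
    (σ : V ≃ V) (hσ : ∀ u v, K u v = K (σ u) (σ v)) {A : Env V → Prop}
    (hA : Measurable fun z => A (Env.ofSites z)) :
    P {ω | A ((E ω).relabel σ)} = P {ω | A (E ω)} := by
  have hmE := hE.isMeasurableEnv
  have hsite : Measurable fun ω => (E ω).sites := measurable_pi_lambda _ fun x =>
    (hmE.isA x).prodMk ((hmE.path x).prodMk ((hmE.clock x).prodMk (hmE.bravery x)))
  have hcomp : Measurable fun (f : ℕ → V) n => σ (f n) :=
    measurable_pi_lambda _ fun n => (measurable_of_countable σ).comp (measurable_pi_apply n)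
  have hsite' : Measurable fun ω => ((E ω).relabel σ).sites := measurable_pi_lambda _ fun x =>
    (hmE.isA _).prodMk ((hcomp.comp (hmE.path _)).prodMk ((hmE.clock _).prodMk (hmE.bravery _)))
  have h := congrArg (fun μ => μ {z | A (Env.ofSites z)}) (hE.map_sites_relabel σ hσ)
  rw [Measure.map_apply hsite (measurableSet_setOfPred.2 hA),
    Measure.map_apply hsite' (measurableSet_setOfPred.2 hA)] at h
  exact h

end Law

/-! ### Almost surely no particle jumps infinitely often in bounded time -/

section NonExplosive

variable {V Ω : Type*} [MeasurableSpace V] [MeasurableSpace Ω] {P : Measure Ω}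
  {E : Ω → Env V} {K : V → V → ℝ≥0} {p : ℝ}

theorem expMeasure_one_Iic_zero : expMeasure 1 (Iic 0) = 0 := by
  have := isProbabilityMeasure_expMeasure one_pos
  rw [← ofReal_cdf, cdf_expMeasure_eq one_pos]
  simp

theorem expMeasure_one_Ioi_one_ne_zero : expMeasure 1 (Ioi 1) ≠ 0 := by
  have := isProbabilityMeasure_expMeasure one_pos
  rw [← compl_Iic, prob_compl_eq_one_sub measurableSet_Iic, ← ofReal_cdf,
    cdf_expMeasure_eq one_pos]
  refine (tsub_pos_of_lt ?_).ne'
  rw [ENNReal.ofReal_lt_one]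
  simp [Real.exp_pos]

theorem exists_lt_sum_range {a : ℕ → ℝ} (h0 : ∀ n, 0 ≤ a n) (h1 : ∃ᶠ n in Filter.atTop, 1 < a n)
    (C : ℝ) : ∃ N, C < ∑ k ∈ Finset.range N, a k := by
  have key : ∀ m : ℕ, ∃ N, (m : ℝ) ≤ ∑ k ∈ Finset.range N, a k := by
    intro m
    induction m with
    | zero => exact ⟨0, by simp⟩
    | succ m ih =>
      obtain ⟨N, hN⟩ := ih
      obtain ⟨n, hn, hn'⟩ := Filter.frequently_atTop.1 h1 N
      refine ⟨n + 1, ?_⟩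
      have := Finset.sum_le_sum_of_subset_of_nonneg (Finset.range_mono hn)
        (f := a) fun i _ _ => h0 i
      rw [Finset.sum_range_succ]
      push_cast
      linarith
  obtain ⟨m, hm⟩ := exists_nat_gt C
  obtain ⟨N, hN⟩ := key m
  exact ⟨N, hm.trans_le hN⟩

/-- By the second Borel–Cantelli lemma the independent waiting times of each particle exceed 1
infinitely often, so their partial sums diverge. -/
theorem IsRandomEnv.ae_nonExplosive [Countable V] [IsProbabilityMeasure P]
    (hE : IsRandomEnv K p P E) (q : Params) :
    ∀ᵐ ω ∂P, NonExplosive q (E ω) := by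
  have hm : ∀ x n, Measurable fun ω => (E ω).clock x n := fun x n =>
    (measurable_pi_apply n).comp (hE.measurable_clock x)
  have h0 : ∀ᵐ ω ∂P, ∀ x n, 0 ≤ (E ω).clock x n := by
    refine ae_all_iff.2 fun x => ae_all_iff.2 fun n => ?_
    refine measure_mono_null (fun ω hω => ?_) (show P ((fun ω => (E ω).clock x n) ⁻¹' Iic 0) = 0 by
      rw [← Measure.map_apply (hm x n) measurableSet_Iic, hE.law_clock,
        expMeasure_one_Iic_zero])
    exact le_of_lt (not_le.1 (show ¬ 0 ≤ (E ω).clock x n from hω))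
  have h1 : ∀ᵐ ω ∂P, ∀ x, ∃ᶠ n in Filter.atTop, 1 < (E ω).clock x n := by
    refine ae_all_iff.2 fun x => ?_
    have hms : ∀ n, MeasurableSet ((fun ω => (E ω).clock x n) ⁻¹' Ioi 1) :=
      fun n => hm x n measurableSet_Ioi
    have hlim := measure_limsup_eq_one hms
      ((iIndepSet_iff_meas_biInter hms).2 fun S =>
        (hE.indep_clock x).measure_inter_preimage_eq_mul S fun _ _ => measurableSet_Ioi) (by
          simp_rw [← Measure.map_apply (hm x _) measurableSet_Ioi, hE.law_clock]
          exact ENNReal.tsum_const_eq_top_of_ne_zero expMeasure_one_Ioi_one_ne_zero)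
    have hml : MeasurableSet (Filter.limsup (fun n => (fun ω => (E ω).clock x n) ⁻¹' Ioi 1)
        Filter.atTop) := MeasurableSet.measurableSet_limsup hms
    have := (prob_compl_eq_zero_iff hml).2 hlim
    filter_upwards [mem_ae_iff.2 this] with ω hω
    exact Filter.mem_limsup_iff_frequently_mem.1 hω
  filter_upwards [h0, h1] with ω h0 h1 y t
  -- A ring by time `t` forces the sum of waiting times to be at most `t` times the rate; positive
  -- parts appear because `ENNReal.ofReal` truncates.
  obtain ⟨N, hN⟩ := exists_lt_sum_range (h0 y) (h1 y) (max t 0 * max (rate q (E ω) y) 0)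
  refine (finite_Iio N).subset fun n hn => ?_
  by_contra hnN
  have hle := Finset.sum_le_sum_of_subset_of_nonneg
    (Finset.range_mono ((not_lt.1 hnN).trans n.le_succ)) (f := (E ω).clock y) fun i _ _ => h0 y i
  have hn : ring q (E ω) y n ≤ ENNReal.ofReal t := hn
  rw [ring, ENNReal.div_le_iff_le_mul (Or.inr ENNReal.ofReal_ne_top)
    (Or.inl ENNReal.ofReal_ne_top)] at hn
  have hlt : max t 0 * max (rate q (E ω) y) 0 < ∑ k ∈ Finset.range (n + 1), (E ω).clock y k :=
    hN.trans_le hle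
  refine absurd hn (not_le.2 ?_)
  have heq : ENNReal.ofReal t * ENNReal.ofReal (rate q (E ω) y)
      = ENNReal.ofReal (max t 0 * max (rate q (E ω) y) 0) := by
    rw [ENNReal.ofReal_mul (le_max_right _ _)]
    simp
  rw [heq]
  exact (ENNReal.ofReal_lt_ofReal_iff_of_nonneg (by positivity)).2 hlt

end NonExplosive

/-! ### Occupation times -/

section Counting

/-- Counting the classes of a given size, weighted by the size, counts the elements. -/
theorem tsum_mul_encard_eq {α β : Type*} (R : α → β → Prop)
    (hR : ∀ u y y', R u y → R u y' → y = y') (hfin : {u | ∃ y, R u y}.Finite) :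
    ∑' i : ℕ, ((i + 1 : ℕ) : ℝ≥0∞) * ({y | {u | R u y}.encard = (i + 1 : ℕ)}.encard : ℝ≥0∞)
      = ({u | ∃ y, R u y}.encard : ℝ≥0∞) := by
  have h1 : ∀ y, ∑' i : ℕ, ((i + 1 : ℕ) : ℝ≥0∞) *
      {y | {u | R u y}.encard = (i + 1 : ℕ)}.indicator 1 y
        = ({u | R u y}.encard : ℝ≥0∞) := by
    intro y
    -- Finiteness is essential: an infinite class would be counted for no `i`.
    have hf : {u | R u y}.Finite := hfin.subset fun u hu => ⟨y, hu⟩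
    simp only [indicator_apply, mem_ofPred_eq, ← hf.cast_ncard_eq, Nat.cast_inj]
    rcases Nat.eq_zero_or_pos {u | R u y}.ncard with h0 | h0
    · simp [h0]
    · rw [tsum_eq_single ({u | R u y}.ncard - 1)]
      · rw [if_pos (by omega), Nat.sub_add_cancel h0]
        simp
      · intro i hi
        rw [if_neg (by omega), mul_zero]
  calc _ = ∑' (i : ℕ) (y : β), ((i + 1 : ℕ) : ℝ≥0∞) *
        {y | {u | R u y}.encard = (i + 1 : ℕ)}.indicator 1 y := by
        refine tsum_congr fun i => ?_
        rw [encard_eq_tsum, ENNReal.tsum_mul_left]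
    _ = ∑' (y : β) (u : α), {u | R u y}.indicator 1 u := by
        rw [ENNReal.tsum_comm]
        exact tsum_congr fun y => by rw [h1, encard_eq_tsum]
    _ = _ := by
        rw [ENNReal.tsum_comm, encard_eq_tsum]
        refine tsum_congr fun u => ?_
        by_cases hu : ∃ y, R u y
        · obtain ⟨y, hy⟩ := hu
          rw [indicator_of_mem (show u ∈ {u | ∃ y, R u y} from ⟨y, hy⟩)]
          exact (tsum_eq_single y fun y' hy' => indicator_of_notMem (s := {u | R u y'})
            (fun h => hy' (hR u y' y h hy)) _).trans (indicator_of_mem (s := {u | R u y}) hy _)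
        · have h0 : ∀ y, u ∉ {u | R u y} := fun y hy => hu ⟨y, hy⟩
          rw [indicator_of_notMem (show u ∉ {u | ∃ y, R u y} from hu)]
          simp [h0]

end Counting

/-! ### Clusters at a site, lifespans and expected occupation -/

section Full

variable {V : Type*} {q : Params}

/-- At time `t` the particle `u` belongs to an `A`-cluster which is at `x`. -/
def ClusterAt (q : Params) (e : Env V) (t : ℝ) (u x : V) : Prop :=
  ∃ y, e.isA y = true ∧ LedByRat q e t u y ∧ pos q e y (ENNReal.ofReal t) = x

theorem clusterAt_relabel (e : Env V) (σ : V ≃ V) (t : ℝ) (u x : V) :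
    ClusterAt q (e.relabel σ) t (σ u) (σ x) ↔ ClusterAt q e t u x := by
  unfold ClusterAt
  rw [← σ.exists_congr_right]
  simp [ledByRat_relabel]

theorem NonExplosive.clusterAt_unique {e : Env V} (h : NonExplosive q e) {t : ℝ} (ht : 0 ≤ t)
    {u x x' : V} (hx : ClusterAt q e t u x) (hx' : ClusterAt q e t u x') : x = x' := by
  obtain ⟨y, -, hy, rfl⟩ := hx
  obtain ⟨y', -, hy', rfl⟩ := hx'
  rw [← h.ledBy_iff_ledByRat ht] at hy hy'
  rw [hy.unique ht hy']

theorem NonExplosive.exists_clusterAt_iff {e : Env V} (h : NonExplosive q e) {t : ℝ} (ht : 0 ≤ t)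
    (u : V) : (∃ x, ClusterAt q e t u x) ↔ e.isA u = true ∧ InSystem q e t u := by
  constructor
  · rintro ⟨x, y, hA, hy, -⟩
    rw [← h.ledBy_iff_ledByRat ht] at hy
    exact ⟨hy.isA_eq.trans hA, y, hy⟩
  · rintro ⟨hA, y, hy⟩
    exact ⟨_, y, hy.isA_eq.symm.trans hA, (h.ledBy_iff_ledByRat ht u y).1 hy, rfl⟩

theorem NonExplosive.tsum_mul_numA {e : Env V} (h : NonExplosive q e) {t : ℝ} (ht : 0 ≤ t) (x : V)
    (hfin : {u | ClusterAt q e t u x}.Finite) :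
    ∑' i : ℕ, ((i + 1 : ℕ) : ℝ≥0∞) * (numA q e (i + 1) t x : ℝ≥0∞)
      = ({u | ClusterAt q e t u x}.encard : ℝ≥0∞) := by
  let R : V → V → Prop := fun u y =>
    e.isA y = true ∧ LedByRat q e t u y ∧ pos q e y (ENNReal.ofReal t) = x
  have hR : ∀ u y y', R u y → R u y' → y = y' := by
    rintro u y y' ⟨-, hy, -⟩ ⟨-, hy', -⟩
    rw [← h.ledBy_iff_ledByRat ht] at hy hy'
    exact hy.unique ht hy'
  refine Eq.trans (tsum_congr fun i => ?_) (tsum_mul_encard_eq R hR hfin)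
  refine congrArg (fun A : Set V => ((i + 1 : ℕ) : ℝ≥0∞) * (A.encard : ℝ≥0∞)) ?_
  ext y
  simp only [mem_ofPred_eq]
  have hcl : e.isA y = true → pos q e y (ENNReal.ofReal t) = x →
      {u | R u y} = {u | LedBy q e t u y} := by
    intro hA hp
    ext u
    simp only [R, hA, hp, mem_ofPred_eq, true_and, and_true, h.ledBy_iff_ledByRat ht]
  constructor
  · rintro ⟨hA, -, hp, hc⟩
    rwa [hcl hA hp]
  · intro hc
    -- The size `i + 1` is positive, so the class has a member; hence `y` is of type `A`, is at `x`
    -- and leads itself, as `numA` demands.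
    have hne : {u | R u y}.Nonempty := by
      rw [← encard_ne_zero, hc]
      exact_mod_cast i.succ_ne_zero
    obtain ⟨u, hA, hu, hp⟩ := hne
    rw [hcl hA hp] at hc
    exact ⟨hA, ((h.ledBy_iff_ledByRat ht u y).2 hu).leader h ht, hp, hc⟩

/-- The comparison is term by term: either no cluster of the given size is present, or one that is
present bounds that size. -/
theorem weightedOccupation_le (e : Env V) (T : ℝ) (x : V) (hq : q.capA < ∞) :
    weightedOccupation q e T x ≤ max 1 (2 * q.capA) * occupation q e T x := by
  unfold weightedOccupation occupation
  rw [← lintegral_const_mul' _ _ (max_lt ENNReal.one_lt_top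
    (ENNReal.mul_lt_top ENNReal.ofNat_lt_top hq)).ne]
  refine setLIntegral_mono' measurableSet_Icc fun t ht => ?_
  rw [← ENNReal.tsum_mul_left]
  refine ENNReal.tsum_le_tsum fun i => ?_
  rcases eq_empty_or_nonempty {y | e.isA y = true ∧ LedBy q e t y y ∧
    pos q e y (ENNReal.ofReal t) = x ∧ {u | LedBy q e t u y}.encard = (i + 1 : ℕ)} with h0 | ⟨y, hy⟩
  · have : numA q e (i + 1) t x = 0 := by rw [numA, h0, encard_empty]
    simp [this]
  · gcongr
    exact encard_cluster_le ht.1 hy.1 hy.2.2.2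

theorem lt_lifespan_imp {e : Env V} {t : ℝ} (ht : 0 ≤ t) {u : V}
    (h : ENNReal.ofReal t < lifespan q e u) : e.isA u = true ∧ InSystem q e t u := by
  unfold lifespan at h
  split_ifs at h with hA
  · refine ⟨hA, by_contra fun hn => absurd h (not_lt.2 (sInf_le ⟨t, ht, rfl, hn⟩))⟩
  · simp at h

/-- Presence at time `t` alone gives only a weak inequality, the lifespan being an infimum; presence
at a later `t'` makes it strict. -/
theorem NonExplosive.lt_lifespan {e : Env V} (hq : NonExplosive q e) {t t' : ℝ} (ht : 0 ≤ t)
    (htt' : t < t') {u : V} (hA : e.isA u = true) (h : InSystem q e t' u) :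
    ENNReal.ofReal t < lifespan q e u := by
  rw [lifespan, if_pos hA]
  refine lt_of_lt_of_le ((ENNReal.ofReal_lt_ofReal_iff_of_nonneg ht).2 htt') (le_sInf ?_)
  rintro _ ⟨s, -, rfl, hs⟩
  refine ENNReal.ofReal_le_ofReal (le_of_not_ge fun hst => hs (h.anti hq hst))

theorem Survives.lifespan_eq_top {e : Env V} {u : V} (h : Survives q e u) :
    lifespan q e u = ∞ := by
  rw [lifespan, if_pos h.1, sInf_eq_top]
  rintro _ ⟨t, ht, -, hn⟩
  exact absurd (h.2 t ht) hn

variable [MeasurableSpace V] [Countable V]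
  {Ω : Type*} [MeasurableSpace Ω]

theorem IsMeasurableEnv.clusterAt [DiscreteMeasurableSpace V] {E : Ω → Env V} (hE : IsMeasurableEnv E) (q : Params)
    {t : Ω → ℝ} (ht : Measurable t) (u x : V) :
    Measurable fun ω => ClusterAt q (E ω) (t ω) u x :=
  Measurable.exists fun y => (measurable_eq_of_countable (hE.isA y) measurable_const).and <|
    (hE.ledByRat q ht u y).and <|
      measurable_eq_of_countable (hE.pos q y ht.ennreal_ofReal) measurable_const

variable {P : Measure Ω} [IsProbabilityMeasure P] {E : Ω → Env V} {K : V → V → ℝ≥0} {p : ℝ}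

/-- By mass transport, the expected number of initial particles in the `A`-clusters at a site is the
probability that the particle started at that site belongs to an `A`-cluster. -/
theorem IsRandomEnv.lintegral_encard_clusterAt [DiscreteMeasurableSpace V]
    (hE : IsRandomEnv K p P E) {G : SimpleGraph V}
    {Γ : Subgroup (G ≃g G)} (hΓ : PreservesKernel K Γ) (htrans : IsTransitive Γ)
    (hunim : IsUnimodular Γ) (q : Params) {t : ℝ} (ht : 0 ≤ t) (o : V) :
    ∫⁻ ω, ({u | ClusterAt q (E ω) t u o}.encard : ℝ≥0∞) ∂P
      = P {ω | (E ω).isA o = true ∧ InSystem q (E ω) t o} := by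
  classical
  have hm : ∀ u x, MeasurableSet {ω | ClusterAt q (E ω) t u x} := fun u x =>
    measurableSet_setOfPred.2 (hE.isMeasurableEnv.clusterAt q measurable_const u x)
  -- Diagonal invariance: relabelling by `φ` preserves both the law of the environment and the
  -- relation `ClusterAt`.
  have hinv : ∀ φ ∈ Γ, ∀ u x, P {ω | ClusterAt q (E ω) t (φ u) (φ x)}
      = P {ω | ClusterAt q (E ω) t u x} := by
    intro φ hφ u x
    rw [← hE.measure_relabel φ.toEquiv (hΓ φ hφ) (A := fun e => ClusterAt q e t (φ u) (φ x))
      (isMeasurableEnv_ofSites.clusterAt q measurable_const _ _)]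
    congr 1
    ext ω
    exact clusterAt_relabel (E ω) φ.toEquiv t u x
  calc ∫⁻ ω, ({u | ClusterAt q (E ω) t u o}.encard : ℝ≥0∞) ∂P
      = ∑' u, P {ω | ClusterAt q (E ω) t u o} := by
        simp_rw [encard_eq_tsum]
        have hind : ∀ u ω, {u | ClusterAt q (E ω) t u o}.indicator (1 : V → ℝ≥0∞) u
            = {ω | ClusterAt q (E ω) t u o}.indicator 1 ω := fun u ω => by
          simp [indicator_apply]
        simp_rw [hind]
        rw [lintegral_tsum fun u => (measurable_one.indicator (hm u o)).aemeasurable]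
        exact tsum_congr fun u => lintegral_indicator_one (hm u o)
    -- Mass transport, `u` sending to `x` the probability that its `A`-cluster is at `x`.
    _ = ∑' x, P {ω | ClusterAt q (E ω) t o x} :=
        (tsum_left_eq_tsum_right htrans hunim
          (fun u x => P {ω | ClusterAt q (E ω) t u x}) hinv o).symm
    _ = P (⋃ x, {ω | ClusterAt q (E ω) t o x}) := by
        refine (measure_iUnion₀ (fun x x' hx => ?_) fun x => (hm o x).nullMeasurableSet).symm
        refine measure_mono_null (fun ω hω => ?_) (ae_iff.1 (hE.ae_nonExplosive q))
        exact fun h => hx (h.clusterAt_unique ht hω.1 hω.2)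
    _ = _ := by
        refine measure_congr ?_
        filter_upwards [hE.ae_nonExplosive q] with ω hω
        refine propext ((mem_iUnion).trans (hω.exists_clusterAt_iff ht o))

open Filter Topology in
-- For `t' > t`, the probability that the lifespan exceeds `t` lies between those of being alive at
-- `t'` and at `t`. The latter is monotone in time, hence continuous off a countable set, and the
-- two bounds meet at its points of continuity.
theorem IsRandomEnv.ae_measure_lt_lifespan (hE : IsRandomEnv K p P E) (q : Params) (o : V) :
    ∀ᵐ t, 0 ≤ t → P {ω | ENNReal.ofReal t < lifespan q (E ω) o}
      = P {ω | (E ω).isA o = true ∧ InSystem q (E ω) t o} := by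
  -- Truncating the time at 0 makes the function antitone on the whole line.
  let h : ℝ → ℝ≥0∞ := fun t => P {ω | (E ω).isA o = true ∧ InSystem q (E ω) (max t 0) o}
  have hanti : Antitone h := by
    intro s t hst
    refine measure_mono_ae ?_
    filter_upwards [hE.ae_nonExplosive q] with ω hω hA
    exact ⟨hA.1, hA.2.anti hω (max_le_max_right 0 hst)⟩
  have hcount := (hanti.countable_not_continuousAt).measure_zero volume
  filter_upwards [(measure_eq_zero_iff_ae_notMem).1 hcount] with t hc ht
  have hc : ContinuousAt h t := by simpa using hc
  have hh : h t = P {ω | (E ω).isA o = true ∧ InSystem q (E ω) t o} := by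
    simp only [h, max_eq_left ht]
  refine le_antisymm (measure_mono fun ω hω => lt_lifespan_imp ht hω) ?_
  rw [← hh]
  refine le_of_tendsto (hc.tendsto.mono_left (nhdsWithin_le_nhds (s := Ioi t))) ?_
  filter_upwards [self_mem_nhdsWithin] with t' ht'
  refine measure_mono_ae ?_
  filter_upwards [hE.ae_nonExplosive q] with ω hω hA
  refine hω.lt_lifespan ht ht' hA.1 ?_
  simpa only [max_eq_left (ht.trans (le_of_lt ht'))] using hA.2

/-- Tonelli is applied to the number of particles in `A`-clusters at `o`, infinite clusters
included. Its integral is at most the length of the time interval, so for almost every realization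
and time the number is finite, and only then does it equal the sum over finite cluster sizes. -/
theorem IsRandomEnv.lintegral_weightedOccupation [DiscreteMeasurableSpace V]
    (hE : IsRandomEnv K p P E) {G : SimpleGraph V}
    {Γ : Subgroup (G ≃g G)} (hΓ : PreservesKernel K Γ) (htrans : IsTransitive Γ)
    (hunim : IsUnimodular Γ) (q : Params) (o : V) (T : ℝ) :
    ∫⁻ ω, weightedOccupation q (E ω) T o ∂P
      = ∫⁻ t in Icc 0 T, P {ω | (E ω).isA o = true ∧ InSystem q (E ω) t o} := by
  let S : Ω → ℝ → ℝ≥0∞ := fun ω t => ({u | ClusterAt q (E ω) t u o}.encard : ℝ≥0∞)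
  have hS : Measurable (Function.uncurry S) := measurable_encard fun u =>
    (hE.isMeasurableEnv.comp measurable_fst).clusterAt q measurable_snd u o
  have hSint : ∫⁻ ω, (∫⁻ t in Icc 0 T, S ω t) ∂P
      = ∫⁻ t in Icc 0 T, P {ω | (E ω).isA o = true ∧ InSystem q (E ω) t o} := by
    rw [lintegral_lintegral_swap hS.aemeasurable]
    exact setLIntegral_congr_fun measurableSet_Icc fun t ht =>
      hE.lintegral_encard_clusterAt hΓ htrans hunim q ht.1 o
  have hfin : ∫⁻ ω, (∫⁻ t in Icc 0 T, S ω t) ∂P ≠ ∞ := by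
    rw [hSint]
    refine ne_top_of_le_ne_top ?_ (lintegral_mono fun t => prob_le_one)
    simp
  rw [← hSint]
  refine lintegral_congr_ae ?_
  filter_upwards [hE.ae_nonExplosive q, ae_lt_top hS.lintegral_prod_right' hfin] with ω hω hlt
  unfold weightedOccupation
  refine lintegral_congr_ae ?_
  filter_upwards [ae_restrict_mem measurableSet_Icc,
    ae_lt_top (hS.comp measurable_prodMk_left) hlt.ne] with t ht hlt'
  refine hω.tsum_mul_numA ht.1 o ?_
  rw [← encard_lt_top_iff]
  exact ENat.toENNReal_lt_top.1 hlt'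

end Full

end DLACS

theorem theorem1p2 {V : Type*} [MeasurableSpace V] [DiscreteMeasurableSpace V]
    (G : SimpleGraph V) [G.LocallyFinite] (hG : G.Connected)
    (K : V → V → ℝ≥0) (hK : DLACS.IsWalkKernel G K)
    (Γ : Subgroup (G ≃g G)) (hΓ : DLACS.PreservesKernel K Γ)
    (htrans : DLACS.IsTransitive Γ) (hunim : DLACS.IsUnimodular Γ)
    (hacc : DLACS.IsInfinitelyAccessible K Γ)
    (q : DLACS.Params) (hrateA : 0 < q.rateA) (hrateB : 0 ≤ q.rateB)
    (p : ℝ) (hp0 : 0 ≤ p) (hp1 : p ≤ 1)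
    {Ω : Type*} [MeasurableSpace Ω] (P : Measure Ω) [IsProbabilityMeasure P]
    (E : Ω → DLACS.Env V) (hE : DLACS.IsRandomEnv K p P E)
    (root : V) (T : ℝ) (hT : 0 ≤ T) :
    ∫⁻ ω, DLACS.weightedOccupation q (E ω) T root ∂P
        = ∫⁻ t in Icc 0 T, P {ω | ENNReal.ofReal t < DLACS.lifespan q (E ω) root} ∧
      P {ω | DLACS.Survives q (E ω) root} * ENNReal.ofReal T
        ≤ ∫⁻ t in Icc 0 T, P {ω | ENNReal.ofReal t < DLACS.lifespan q (E ω) root} ∧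
      (q.capA < ∞ →
        P {ω | DLACS.Survives q (E ω) root} / max 1 (2 * q.capA) * ENNReal.ofReal T
          ≤ ∫⁻ ω, DLACS.occupation q (E ω) T root ∂P) := by
  have := hG.countable
  have hW : ∫⁻ ω, DLACS.weightedOccupation q (E ω) T root ∂P
      = ∫⁻ t in Icc 0 T, P {ω | ENNReal.ofReal t < DLACS.lifespan q (E ω) root} := by
    rw [hE.lintegral_weightedOccupation hΓ htrans hunim]
    refine lintegral_congr_ae ?_
    filter_upwards [ae_restrict_mem measurableSet_Icc,
      ae_restrict_of_ae (hE.ae_measure_lt_lifespan q root)] with t ht h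
    exact (h ht.1).symm
  have hθ : P {ω | DLACS.Survives q (E ω) root} * ENNReal.ofReal T
      ≤ ∫⁻ t in Icc 0 T, P {ω | ENNReal.ofReal t < DLACS.lifespan q (E ω) root} := by
    calc P {ω | DLACS.Survives q (E ω) root} * ENNReal.ofReal T
        = ∫⁻ _ in Icc 0 T, P {ω | DLACS.Survives q (E ω) root} := by simp
      _ ≤ _ := lintegral_mono fun t => measure_mono fun ω hω => by
          rw [mem_ofPred_eq, DLACS.Survives.lifespan_eq_top hω]
          exact ENNReal.ofReal_lt_top
  refine ⟨hW, hθ, fun hq => ?_⟩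
  have hC : max 1 (2 * q.capA) ≠ ∞ :=
    (max_lt ENNReal.one_lt_top (ENNReal.mul_lt_top ENNReal.ofNat_lt_top hq)).ne
  rw [← ENNReal.mul_div_right_comm]
  -- With `C = max 1 (2 * M)`, the chain is `θ T ≤ E[W_T] ≤ C E[V_T]`; finiteness of `C` allows it
  -- to be taken out of the integral without measurability of the occupation time.
  refine ENNReal.div_le_of_le_mul' ((hθ.trans_eq hW.symm).trans ?_)
  rw [← lintegral_const_mul' _ _ hC]
  exact lintegral_mono fun ω => DLACS.weightedOccupation_le (E ω) T root hq
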